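/- Let $N\ge 3$ be an integer, let $\alpha,\beta\ge 1$ be real with $\alpha\beta>1$, and let $p,q:\mathbf R^N\to[0,\infty)$ be continuous. For $r>0$ put $$\tilde p(r)=\begin{cases}\Bigl(\dfrac1{\omega_N r^{N-1}}\displaystyle\int_{|x|=r}p(x)^{1/(1-\alpha)}\,dS\Bigr)^{1-\alpha},&\alpha>1,\\[2mm] \min_{|x|=r}p(x),&\alpha=1,\end{cases}\qquad \tilde q(r)=\begin{cases}\Bigl(\dfrac1{\omega_N r^{N-1}}\displaystyle\int_{|x|=r}q(x)^{1/(1-\beta)}\,dS\Bigr)^{1-\beta},&\beta>1,\\[2mm] \min_{|x|=r}q(x),&\beta=1,\end{cases}$$ where $\omega_N$ is the surface area of the unit sphere of $\mathbf R^N$, a negative power of $0$ is $\infty$, and $\tilde p(r)=0$ (respectively $\tilde q(r)=0$) when the corresponding integral is infinite. Let $m,n\ge 1$ be integers and $\rho>0$ be such that $r^{1-m}\tilde p(r)$ and $r^{1-n}\tilde q(r)$ are nonincreasing on $(\rho,\infty)$. Define $u_0=v_0=1$ and, for integers $k\ge1$, $$u_k(r)=\frac1{N-2}\int_\rho^r s\,\tilde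 p(s)\Bigl[1-\Bigl(\frac sr\Bigr)^{N-2}\Bigr]v_{k-1}^\alpha(s)\,ds,\qquad v_k(r)=\frac1{N-2}\int_\rho^r s\,\tilde q(s)\Bigl[1-\Bigl(\frac sr\Bigr)^{N-2}\Bigr]u_{k-1}^\beta(s)\,ds,$$ and, for $a>1$, $$y_k(R)=\int_R^{aR}(aR-s)^m s^{1-m}\tilde p(s)v_k^\alpha(s)\,ds,\qquad z_k(R)=\int_R^{aR}(aR-s)^n s^{1-n}\tilde q(s)u_k^\beta(s)\,ds.$$ Suppose that for some integer $k\ge1$ and some $1<a<b\le 2$ at least one of the conditions $$\limsup_{R\to\infty}\; y_k^{\frac{\alpha\beta-1}{(n+1)\alpha+m+1}}(R)\int_{aR}^{bR}\Bigl(s^{1-m}\tilde p(s)\,\bigl(s^{1-n}\tilde q(s)\bigr)^\alpha\Bigr)^{\frac1{(n+1)\alpha+m+1}}ds=\infty,$$ $$\limsup_{R\to\infty}\; z_k^{\frac{\alpha\beta-1}{(m+1)\beta+n+1}}(R)\int_{aR}^{bR}\Bigl(s^{1-n}\tilde q(s)\,\bigl(s^{1-m}\tilde p(s)\bigr)^\beta\Bigr)^{\frac1{(m+1)\beta+n+1}}ds=\infty$$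 holds. Then the system $$\Delta u=p(x)v^\alpha,\qquad \Delta v=q(x)u^\beta\qquad\text{on }\mathbf R^N$$ has no nontrivial nonnegative entire solution, i.e. the only pair of nonnegative functions $u,v\in C^2(\mathbf R^N)$ satisfying it at every point of $\mathbf R^N$ is $(u,v)=(0,0)$. -/

import Mathlib

open MeasureTheory Filter Set
open scoped ENNReal

noncomputable section

namespace EllipticSystem

/-- The space `ℝ^N` with its Euclidean norm. -/
abbrev Space (N : ℕ) : Type := EuclideanSpace ℝ (Fin N)

/-- The surface measure `dS` on the unit sphere of `ℝ^N`. -/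
def unitSphereMeasure (N : ℕ) : Measure (Metric.sphere (0 : Space N) 1) :=
  (volume : Measure (Space N)).toSphere

/-- The average `(1 / (ω_N r^(N-1))) ∫_{|x| = r} f dS` of a `[0,∞]`-valued function over the sphere
of radius `r > 0`, that is, the average over the unit sphere of `θ ↦ f (r θ)`. -/
def sphereMean {N : ℕ} (f : Space N → ℝ≥0∞) (r : ℝ) : ℝ≥0∞ :=
  (∫⁻ θ, f (r • (θ : Space N)) ∂(unitSphereMeasure N)) / unitSphereMeasure N univ

/-- The radial weight `p̃` attached to a nonnegative weight `p` and an exponent `α ≥ 1`: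
the minimum of `p` over `|x| = r` if `α = 1`, and otherwise the power `1 - α` of the average of
`p^(1/(1-α))` over `|x| = r`. The latter average is taken in `[0,∞]`, with `0^(1/(1-α)) = ∞`,
and `p̃ r = 0` if it is infinite (as `∞^(1-α) = 0`). -/
def radialWeight {N : ℕ} (α : ℝ) (p : Space N → ℝ) (r : ℝ) : ℝ :=
  if α = 1 then sInf (p '' Metric.sphere 0 r)
  else ((sphereMean (fun x => ENNReal.ofReal (p x) ^ (1 / (1 - α))) r) ^ (1 - α)).toReal

/-- The operator
`w ↦ (1 / (N-2)) ∫_ρ^r s f(s) (1 - (s/r)^(N-2)) w(s)^γ ds`. -/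
def radialStep (N : ℕ) (ρ : ℝ) (f : ℝ → ℝ) (γ : ℝ) (w : ℝ → ℝ) (r : ℝ) : ℝ :=
  1 / ((N : ℝ) - 2) * ∫ s in ρ..r, s * f s * (1 - (s / r) ^ (N - 2)) * w s ^ γ

/-- The pair `(u_k, v_k)`: `u_0 = v_0 = 1`, and `u_k` is built from `v_{k-1}` with the weight `P`
and the exponent `α`, `v_k` from `u_{k-1}` with the weight `Q` and the exponent `β`. -/
def iterate (N : ℕ) (ρ α β : ℝ) (P Q : ℝ → ℝ) : ℕ → (ℝ → ℝ) × (ℝ → ℝ)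
  | 0 => (fun _ => 1, fun _ => 1)
  | k + 1 =>
    (radialStep N ρ P α (iterate N ρ α β P Q k).2, radialStep N ρ Q β (iterate N ρ α β P Q k).1)

/-- `∫_R^{aR} (aR-s)^m s^(1-m) f(s) w(s)^γ ds`. -/
def shellIntegral (m : ℕ) (a : ℝ) (f : ℝ → ℝ) (γ : ℝ) (w : ℝ → ℝ) (R : ℝ) : ℝ :=
  ∫ s in R..(a * R), (a * R - s) ^ m * s ^ (1 - (m : ℤ)) * f s * w s ^ γ

/-- `y_k(R) = ∫_R^{aR} (aR-s)^m s^(1-m) P(s) v_k(s)^α ds`. -/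
def yFun (N m : ℕ) (ρ a α β : ℝ) (P Q : ℝ → ℝ) (k : ℕ) (R : ℝ) : ℝ :=
  shellIntegral m a P α (iterate N ρ α β P Q k).2 R

/-- `z_k(R) = ∫_R^{aR} (aR-s)^n s^(1-n) Q(s) u_k(s)^β ds`. -/
def zFun (N n : ℕ) (ρ a α β : ℝ) (P Q : ℝ → ℝ) (k : ℕ) (R : ℝ) : ℝ :=
  shellIntegral n a Q β (iterate N ρ α β P Q k).1 R

/-- `(u, v)` is a nonnegative entire solution of `Δu = p v^α`, `Δv = q u^β`: both functions are
`C²` and nonnegative on `ℝ^N` and the equations hold at every point. -/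
structure IsNonnegEntireSolution {N : ℕ} (α β : ℝ) (p q u v : Space N → ℝ) : Prop where
  contDiff_u : ContDiff ℝ 2 u
  contDiff_v : ContDiff ℝ 2 v
  nonneg_u : ∀ x, 0 ≤ u x
  nonneg_v : ∀ x, 0 ≤ v x
  eq_u : ∀ x, Laplacian.laplacian u x = p x * v x ^ α
  eq_v : ∀ x, Laplacian.laplacian v x = q x * u x ^ β

end EllipticSystem

end

noncomputable section

namespace EllipticSystem

/-! Let `U`, `V` be the spherical means of `u`, `v`. The divergence theorem on balls expresses the
growth of `U` through the mean of `Δu = p v^α`, and a reverse Hölder inequality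
(`radialWeight_mul_avg_rpow_le`) bounds that mean below by `p̃ V^α`. So `U` and `V` satisfy integral
inequalities with the radial weights (`radialGrowth_avg`), and everything afterwards is
one-dimensional.

Put `σ = (n+1)α + m + 1` and let `h` be the integrand of the first growth condition. On `[s, t]`
with `t ≤ 2s` the kernel is at least `(t-τ)/2`, hence at least half of `(t-τ)^m τ^(1-m)`.
Monotonicity of `τ^(1-n) q̃` and of `U` gives a lower bound for `V(τ)` of order `τ^(1-n) q̃(τ)
U(s)^β (τ-s)^(n+1)`. Inserting it into the inequality for `U(t)` and applying Hölder with the weight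
`(t-τ)^m (τ-s)^((n+1)α)` yields `∫_s^t h ≤ C U(t)^(1/σ) U(s)^(-αβ/σ)` (`integral_density_le`).
Cutting an interval where `U` doubles produces a geometric series, convergent because `αβ > 1`, and
`∫_c^d h ≤ C U(c)^(-(αβ-1)/σ)` (`integral_density_le_rpow`).

In the other direction, the iterates are dominated by multiples of `U` and `V`
(`exists_iterate_le`), so `y_k(R) ≤ C U(aR)`. In the product of the growth condition the powers of
`U(aR)` cancel, so the product stays bounded and its limsup is finite. If exactly one of `U`, `V`
vanishes identically, the weight multiplying the other vanishes near infinity and the product is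
eventually zero. The second condition is the first one with the two equations exchanged. -/

variable {N : ℕ}

/-! ### Spherical means and the reverse Hölder inequality. -/

/-- The normalised surface measure on the unit sphere. -/
def sphereProb (N : ℕ) : Measure (Metric.sphere (0 : Space N) 1) :=
  (unitSphereMeasure N univ)⁻¹ • unitSphereMeasure N

instance [NeZero N] : IsFiniteMeasure (unitSphereMeasure N) := by
  unfold unitSphereMeasure; infer_instance

instance [NeZero N] : (unitSphereMeasure N).IsOpenPosMeasure := by
  unfold unitSphereMeasure; infer_instance

instance [NeZero N] : NeZero (unitSphereMeasure N) :=
  ⟨Measure.toSphere_ne_zero _⟩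

instance [NeZero N] : IsProbabilityMeasure (sphereProb N) := by
  unfold sphereProb; infer_instance

instance [NeZero N] : (sphereProb N).IsOpenPosMeasure := by
  unfold sphereProb
  exact Measure.isOpenPosMeasure_smul _ (ENNReal.inv_ne_zero.2 (measure_ne_top _ _))

/-- The mean of a real function over the sphere of radius `r`. -/
def avg (f : Space N → ℝ) (r : ℝ) : ℝ := ∫ θ, f (r • (θ : Space N)) ∂(sphereProb N)

theorem sphereMean_eq (f : Space N → ℝ≥0∞) (r : ℝ) :
    sphereMean f r = ∫⁻ θ, f (r • (θ : Space N)) ∂(sphereProb N) := by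
  rw [sphereMean, sphereProb, lintegral_smul_measure, ENNReal.div_eq_inv_mul, smul_eq_mul]

theorem continuous_smul_sphere (r : ℝ) :
    Continuous fun θ : Metric.sphere (0 : Space N) 1 => r • (θ : Space N) := by fun_prop

theorem integrable_sphere [NeZero N] {g : Metric.sphere (0 : Space N) 1 → ℝ} (hg : Continuous g) :
    Integrable g (sphereProb N) :=
  hg.integrable_of_hasCompactSupport (HasCompactSupport.of_compactSpace _)

theorem avg_nonneg {f : Space N → ℝ} (hf : ∀ x, 0 ≤ f x) (r : ℝ) : 0 ≤ avg f r :=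
  integral_nonneg fun _ => hf _

theorem continuous_avg_param [NeZero N] {F : ℝ → Metric.sphere (0 : Space N) 1 → ℝ}
    (hF : Continuous (Function.uncurry F)) :
    Continuous fun r => ∫ θ, F r θ ∂(sphereProb N) := by
  simpa using continuous_parametric_integral_of_continuous (μ := sphereProb N) hF isCompact_univ

theorem continuous_avg [NeZero N] {f : Space N → ℝ} (hf : Continuous f) : Continuous (avg f) :=
  continuous_avg_param (F := fun r (θ : Metric.sphere (0 : Space N) 1) => f (r • (θ : Space N))) (by fun_prop)

theorem avg_const_one [NeZero N] (r : ℝ) : avg (fun _ : Space N => (1 : ℝ)) r = 1 := by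
  simp [avg]

theorem avg_pos [NeZero N] {f : Space N → ℝ} (hf : Continuous f) (h0 : ∀ x, 0 ≤ f x)
    {x : Space N} (hx : x ≠ 0) (hfx : 0 < f x) : 0 < avg f ‖x‖ := by
  have hc : Continuous fun θ : Metric.sphere (0 : Space N) 1 => f (‖x‖ • (θ : Space N)) := by
    fun_prop
  have hn : ‖x‖ ≠ 0 := norm_ne_zero_iff.2 hx
  refine (integral_pos_iff_support_of_nonneg (fun θ => h0 _) (integrable_sphere hc)).2 ?_
  refine (hc.isOpen_support).measure_pos _ ⟨⟨‖x‖⁻¹ • x, ?_⟩, ?_⟩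
  · simp [norm_smul, hn]
  · simp only [Function.mem_support, smul_smul, mul_inv_cancel₀ hn, one_smul]
    exact hfx.ne'

theorem radialWeight_nonneg {α : ℝ} {p : Space N → ℝ} (hp0 : ∀ x, 0 ≤ p x) (r : ℝ) :
    0 ≤ radialWeight α p r := by
  unfold radialWeight
  split_ifs
  · apply Real.sInf_nonneg
    rintro _ ⟨x, -, rfl⟩
    exact hp0 x
  · exact ENNReal.toReal_nonneg

theorem radialWeight_one_mul_avg_le [NeZero N] {p w : Space N → ℝ} (hp : Continuous p)
    (hw : Continuous w) (hp0 : ∀ x, 0 ≤ p x) (hw0 : ∀ x, 0 ≤ w x) {r : ℝ} (hr : 0 ≤ r) :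
    sInf (p '' Metric.sphere 0 r) * avg w r ≤ avg (fun x => p x * w x) r := by
  unfold avg
  rw [← integral_const_mul]
  refine integral_mono (integrable_sphere (by fun_prop)) (integrable_sphere (by fun_prop)) ?_
  intro θ
  refine mul_le_mul_of_nonneg_right (csInf_le ⟨0, ?_⟩ ⟨_, ?_, rfl⟩) (hw0 _)
  · rintro _ ⟨x, -, rfl⟩
    exact hp0 x
  · simp [norm_smul, abs_of_nonneg hr]

theorem ofReal_avg [NeZero N] {f : Space N → ℝ} (hf : Continuous f) (h0 : ∀ x, 0 ≤ f x) (r : ℝ) :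
    ENNReal.ofReal (avg f r) = ∫⁻ θ, ENNReal.ofReal (f (r • (θ : Space N))) ∂(sphereProb N) :=
  ofReal_integral_eq_lintegral_ofReal (integrable_sphere (by fun_prop))
    (Eventually.of_forall fun _ => h0 _)

/-- The reverse Hölder inequality behind the radial weight. -/
theorem radialWeight_mul_avg_rpow_le [NeZero N] {α : ℝ} (hα : 1 ≤ α) {p w : Space N → ℝ}
    (hp : Continuous p) (hw : Continuous w) (hp0 : ∀ x, 0 ≤ p x) (hw0 : ∀ x, 0 ≤ w x)
    {r : ℝ} (hr : 0 ≤ r) :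
    radialWeight α p r * avg w r ^ α ≤ avg (fun x => p x * w x ^ α) r := by
  unfold radialWeight
  split_ifs with h1
  · subst h1
    simpa using radialWeight_one_mul_avg_le hp hw hp0 hw0 hr
  have hα1 : 1 < α := lt_of_le_of_ne hα (Ne.symm h1)
  have hα0 : 0 < α := by linarith
  have hcont : Continuous fun x => p x * w x ^ α :=
    hp.mul (hw.rpow_const fun _ => Or.inr hα0.le)
  have hnn : ∀ x, 0 ≤ p x * w x ^ α := fun x => mul_nonneg (hp0 x) (Real.rpow_nonneg (hw0 x) _)
  have hRHS := avg_nonneg hnn r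
  set μ := sphereMean (fun x => ENNReal.ofReal (p x) ^ (1 / (1 - α))) r with hμ
  rcases eq_or_ne μ ∞ with hT | hT
  · rw [hT, ENNReal.top_rpow_of_neg (by linarith)]
    simpa using hRHS
  -- Here the negative power is `∞`, whose `toReal` is `0`, so the claim is again trivial.
  -- Afterwards `μ` is positive and finite, and its powers may be cancelled.
  rcases eq_or_ne μ 0 with hZ | hZ
  · rw [hZ, ENNReal.zero_rpow_of_neg (by linarith)]
    simpa using hRHS
  rw [sphereMean_eq] at hμ
  -- Hölder is applied to `w = (p w^α)^(1/α) · p^(-1/α)` with exponents `α` and `α/(α-1)`; the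
  -- second factor integrates to `μ`.
  set f : Metric.sphere (0 : Space N) 1 → ℝ≥0∞ := fun θ =>
    ENNReal.ofReal (p (r • (θ : Space N)) * w (r • (θ : Space N)) ^ α) ^ (1 / α) with hf
  set g : Metric.sphere (0 : Space N) 1 → ℝ≥0∞ := fun θ =>
    ENNReal.ofReal (p (r • (θ : Space N))) ^ (-(1 / α)) with hg
  have hpm : Measurable fun θ : Metric.sphere (0 : Space N) 1 =>
      ENNReal.ofReal (p (r • (θ : Space N))) :=
    (ENNReal.continuous_ofReal.comp (hp.comp (continuous_smul_sphere r))).measurable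
  have hfm : Measurable f :=
    (ENNReal.continuous_ofReal.comp
      (hcont.comp (continuous_smul_sphere r))).measurable.pow_const _
  have hgm : Measurable g := hpm.pow_const _
  have hconj : α.HolderConjugate (α / (α - 1)) := Real.HolderConjugate.conjExponent hα1
  have hHol := ENNReal.lintegral_mul_le_Lp_mul_Lq (sphereProb N) hconj hfm.aemeasurable
    hgm.aemeasurable
  have hae : ∀ᵐ θ : Metric.sphere (0 : Space N) 1 ∂(sphereProb N), ENNReal.ofReal (w (r • (θ : Space N))) ≤ (f * g) θ := by
    have hlt : ∀ᵐ θ : Metric.sphere (0 : Space N) 1 ∂(sphereProb N),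
        ENNReal.ofReal (p (r • (θ : Space N))) ^ (1 / (1 - α)) < ∞ :=
      ae_lt_top (hpm.pow_const _) (hμ ▸ hT)
    filter_upwards [hlt] with θ hθ
    -- A zero of `p` would make the integrand of `μ` infinite, so finiteness of `μ` gives `p > 0`
    -- almost everywhere on the sphere.
    have hpp : 0 < p (r • (θ : Space N)) := by
      by_contra hcon
      rw [ENNReal.ofReal_of_nonpos (not_lt.1 hcon), ENNReal.zero_rpow_of_neg] at hθ
      · exact lt_irrefl _ hθ
      · exact div_neg_of_pos_of_neg one_pos (by linarith)
    simp only [Pi.mul_apply, hf, hg]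
    rw [ENNReal.ofReal_rpow_of_nonneg (hnn _) (by positivity), ENNReal.ofReal_rpow_of_pos hpp,
      ← ENNReal.ofReal_mul (by positivity [hnn (r • (θ : Space N))])]
    apply le_of_eq
    congr 1
    rw [Real.mul_rpow hpp.le (Real.rpow_nonneg (hw0 _) _), ← Real.rpow_mul (hw0 _),
      mul_one_div_cancel hα0.ne', Real.rpow_one, mul_right_comm, ← Real.rpow_add hpp]
    simp
  have h2 := (lintegral_mono_ae hae).trans hHol
  have e1 : ∀ θ, f θ ^ α = ENNReal.ofReal (p (r • (θ : Space N)) * w (r • (θ : Space N)) ^ α) := by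
    intro θ
    rw [hf, ← ENNReal.rpow_mul, one_div_mul_cancel hα0.ne', ENNReal.rpow_one]
  have e2 : ∀ θ, g θ ^ (α / (α - 1)) = ENNReal.ofReal (p (r • (θ : Space N))) ^ (1 / (1 - α)) := by
    intro θ
    rw [hg, ← ENNReal.rpow_mul]
    congr 1
    have : α - 1 ≠ 0 := by linarith
    have : 1 - α ≠ 0 := by intro h; apply h1; linarith
    field_simp
    ring
  simp only [e1, e2] at h2
  rw [← hμ, ← ofReal_avg hw hw0, ← ofReal_avg hcont hnn] at h2
  have h3 := ENNReal.rpow_le_rpow h2 hα0.le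
  rw [ENNReal.mul_rpow_of_nonneg _ _ hα0.le, ← ENNReal.rpow_mul, ← ENNReal.rpow_mul,
    one_div_mul_cancel hα0.ne', ENNReal.rpow_one] at h3
  have e3 : 1 / (α / (α - 1)) * α = α - 1 := by
    have : α - 1 ≠ 0 := by linarith
    field_simp
  rw [e3] at h3
  have h4 : μ ^ (1 - α) * ENNReal.ofReal (avg w r) ^ α
      ≤ ENNReal.ofReal (avg (fun x => p x * w x ^ α) r) := by
    calc _ ≤ μ ^ (1 - α) * (ENNReal.ofReal (avg (fun x => p x * w x ^ α) r) * μ ^ (α - 1)) := by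
          gcongr
      _ = _ := by
        rw [mul_left_comm, ← ENNReal.rpow_add _ _ hZ hT]
        simp
  have h5 := ENNReal.toReal_mono ENNReal.ofReal_ne_top h4
  rwa [ENNReal.toReal_mul, ← ENNReal.toReal_rpow, ENNReal.toReal_ofReal hRHS,
    ← ENNReal.toReal_rpow, ENNReal.toReal_ofReal (avg_nonneg hw0 r), ENNReal.toReal_rpow] at h5

/-! ### Flux through spheres and the divergence theorem on balls. -/

/-- The mean of the radial derivative over the sphere of radius `r`. -/
def radialDerivAvg (u : Space N → ℝ) (r : ℝ) : ℝ :=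
  ∫ θ, fderiv ℝ u (r • (θ : Space N)) (θ : Space N) ∂(sphereProb N)

theorem hasDerivAt_smul_sphere {u : Space N → ℝ} (hu : ContDiff ℝ 1 u) (x : Space N) (r : ℝ) :
    HasDerivAt (fun r : ℝ => u (r • x)) (fderiv ℝ u (r • x) x) r := by
  have h1 : HasFDerivAt u (fderiv ℝ u (r • x)) (r • x) :=
    (hu.differentiable one_ne_zero _).hasFDerivAt
  have h2 : HasDerivAt (fun r : ℝ => r • x) x r := by
    simpa using (hasDerivAt_id r).smul_const x
  exact h1.comp_hasDerivAt r h2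

theorem continuous_fderiv_smul_sphere {u : Space N → ℝ} (hu : ContDiff ℝ 1 u) :
    Continuous (Function.uncurry fun (r : ℝ) (θ : Metric.sphere (0 : Space N) 1) =>
      fderiv ℝ u (r • (θ : Space N)) (θ : Space N)) := by
  have h := hu.continuous_fderiv one_ne_zero
  unfold Function.uncurry
  fun_prop

theorem continuous_radialDerivAvg [NeZero N] {u : Space N → ℝ} (hu : ContDiff ℝ 1 u) :
    Continuous (radialDerivAvg u) :=
  continuous_avg_param (continuous_fderiv_smul_sphere hu)

theorem hasDerivAt_avg [NeZero N] {u : Space N → ℝ} (hu : ContDiff ℝ 1 u) (r : ℝ) :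
    HasDerivAt (avg u) (radialDerivAvg u r) r := by
  have hcont := continuous_fderiv_smul_sphere hu
  have hK : IsCompact (Metric.closedBall r 1 ×ˢ
      (univ : Set (Metric.sphere (0 : Space N) 1))) :=
    (isCompact_closedBall r 1).prod isCompact_univ
  obtain ⟨C, hC⟩ := hK.exists_bound_of_continuousOn hcont.continuousOn
  refine (hasDerivAt_integral_of_dominated_loc_of_deriv_le (μ := sphereProb N)
    (F := fun (r : ℝ) (θ : Metric.sphere (0 : Space N) 1) => u (r • (θ : Space N)))
    (F' := fun (r : ℝ) (θ : Metric.sphere (0 : Space N) 1) =>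
      fderiv ℝ u (r • (θ : Space N)) (θ : Space N)) (bound := fun _ => C)
    (Metric.closedBall_mem_nhds r one_pos) ?_ ?_ ?_ ?_ ?_ ?_).2
  · exact Eventually.of_forall fun s =>
      (hu.continuous.comp (continuous_smul_sphere s)).aestronglyMeasurable
  · exact integrable_sphere (hu.continuous.comp (continuous_smul_sphere r))
  · exact (hcont.comp (Continuous.prodMk_right r)).aestronglyMeasurable
  · exact Eventually.of_forall fun θ s hs => hC (s, θ) ⟨hs, mem_univ _⟩
  · exact integrable_const _
  · exact Eventually.of_forall fun θ s _ => hasDerivAt_smul_sphere hu _ s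

theorem integral_sphereProb (g : Metric.sphere (0 : Space N) 1 → ℝ) :
    ∫ θ, g θ ∂(sphereProb N) = ((unitSphereMeasure N).real univ)⁻¹ *
      ∫ θ, g θ ∂(unitSphereMeasure N) := by
  rw [sphereProb, integral_smul_measure, ENNReal.toReal_inv, smul_eq_mul, Measure.real]

/-- Integration in polar coordinates. -/
theorem integral_polar [NeZero N] {F : Space N → ℝ} (hF : Integrable F) :
    ∫ x, F x = (unitSphereMeasure N).real univ * ∫ r in Ioi (0 : ℝ), r ^ (N - 1) * avg F r := by
  have hfr : Module.finrank ℝ (Space N) = N := by simp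
  have hmp := (volume : Measure (Space N)).measurePreserving_homeomorphUnitSphereProd
  set G : Metric.sphere (0 : Space N) 1 × Ioi (0 : ℝ) → ℝ := fun z => F ((z.2 : ℝ) • (z.1 : Space N))
    with hG
  have hGF : ∀ x : ({0}ᶜ : Set (Space N)), G (homeomorphUnitSphereProd (Space N) x) = F x := by
    intro x
    have hx : ‖(x : Space N)‖ ≠ 0 := norm_ne_zero_iff.2 x.2
    simp [hG, smul_smul, hx]
  have hint : Integrable G ((volume : Measure (Space N)).toSphere.prod
      (.volumeIoiPow (Module.finrank ℝ (Space N) - 1))) := by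
    rw [← hmp.integrable_comp_emb (Homeomorph.measurableEmbedding _)]
    simp only [Function.comp_def, hGF]
    exact (integrableOn_iff_comap_subtypeVal (measurableSet_singleton _).compl).1 hF.integrableOn
  have hne : (unitSphereMeasure N).real univ ≠ 0 :=
    (measureReal_ne_zero_iff (measure_ne_top _ _)).2
      (Measure.measure_univ_ne_zero.2 (NeZero.ne _))
  calc ∫ x, F x = ∫ x : ({0}ᶜ : Set (Space N)), F x ∂(volume.comap Subtype.val) := by
        rw [integral_subtype_comap (measurableSet_singleton _).compl F, restrict_compl_singleton]
    _ = ∫ z, G z ∂((volume : Measure (Space N)).toSphere.prod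
          (.volumeIoiPow (Module.finrank ℝ (Space N) - 1))) := by
        rw [← hmp.integral_comp (Homeomorph.measurableEmbedding _)]
        simp only [hGF]
    _ = ∫ r : Ioi (0 : ℝ), (∫ θ, F ((r : ℝ) • (θ : Space N)) ∂(unitSphereMeasure N))
          ∂(Measure.volumeIoiPow (N - 1)) := by
        rw [integral_prod_symm _ hint, hfr]
        rfl
    _ = ∫ r : Ioi (0 : ℝ), (unitSphereMeasure N).real univ * avg F r
          ∂(Measure.volumeIoiPow (N - 1)) := by
        congr 1
        ext r
        rw [avg, integral_sphereProb, mul_inv_cancel_left₀ hne]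
    _ = _ := by
        rw [integral_const_mul]
        congr 1
        simp only [Measure.volumeIoiPow, ENNReal.ofReal]
        rw [integral_withDensity_eq_integral_smul,
          integral_subtype_comap measurableSet_Ioi
            fun a ↦ Real.toNNReal (a ^ (N - 1)) • avg F a,
          setIntegral_congr_fun measurableSet_Ioi fun x hx ↦ ?_]
        · rw [NNReal.smul_def, Real.coe_toNNReal _ (pow_nonneg hx.out.le _), smul_eq_mul]
        · exact (measurable_subtype_coe.pow_const _).real_toNNReal

theorem laplacian_eq_sum {u : Space N → ℝ} (hu : ContDiff ℝ 2 u) (x : Space N) :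
    Laplacian.laplacian u x = ∑ i, fderiv ℝ
      (fun y => fderiv ℝ u y (EuclideanSpace.basisFun (Fin N) ℝ i)) x
      (EuclideanSpace.basisFun (Fin N) ℝ i) := by
  rw [InnerProductSpace.laplacian_eq_iteratedFDeriv_orthonormalBasis u
    (EuclideanSpace.basisFun (Fin N) ℝ)]
  refine Finset.sum_congr rfl fun i _ => ?_
  have hd : DifferentiableAt ℝ (fderiv ℝ u) x :=
    (hu.fderiv_right (m := 1) (by norm_num)).differentiable one_ne_zero x
  rw [iteratedFDeriv_two_apply, fderiv_clm_apply hd (differentiableAt_const _)]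
  simp

theorem contDiff_fderiv_apply {u : Space N → ℝ} (hu : ContDiff ℝ 2 u) (v : Space N) :
    ContDiff ℝ 1 fun y => fderiv ℝ u y v :=
  (hu.fderiv_right (m := 1) (by norm_num)).clm_apply contDiff_const

theorem continuous_laplacian {u : Space N → ℝ} (hu : ContDiff ℝ 2 u) :
    Continuous (Laplacian.laplacian u : Space N → ℝ) := by
  have : (Laplacian.laplacian u : Space N → ℝ) = _ := funext (laplacian_eq_sum hu)
  rw [this]
  exact continuous_finsetSum _ fun i _ =>
    ((contDiff_fderiv_apply hu _).continuous_fderiv one_ne_zero).clm_apply continuous_const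

theorem hasFDerivAt_norm {x : Space N} (hx : x ≠ 0) :
    HasFDerivAt (fun y : Space N => ‖y‖) (‖x‖⁻¹ • innerSL ℝ x) x := by
  have h := ((hasStrictFDerivAt_norm_sq x).hasFDerivAt).sqrt (by simpa using hx)
  have hx' : ‖x‖ ≠ 0 := norm_ne_zero_iff.2 hx
  simp only [Real.sqrt_sq (norm_nonneg _)] at h
  refine h.congr_fderiv ?_
  ext y
  simp
  field_simp

theorem sum_inner_mul_fderiv {u : Space N → ℝ} (x : Space N) :
    ∑ i, inner ℝ x (EuclideanSpace.basisFun (Fin N) ℝ i) *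
      fderiv ℝ u x (EuclideanSpace.basisFun (Fin N) ℝ i) = fderiv ℝ u x x := by
  refine Eq.trans ?_ (congrArg (fderiv ℝ u x) ((EuclideanSpace.basisFun (Fin N) ℝ).sum_repr' x))
  rw [map_sum]
  refine Finset.sum_congr rfl fun i _ => ?_
  rw [map_smul, smul_eq_mul, real_inner_comm]

/-- Integration by parts against a radial test function whose radial derivative is `r * k r`. -/
theorem integral_radial_mul_laplacian {u : Space N → ℝ} (hu : ContDiff ℝ 2 u) {Φ k : ℝ → ℝ}
    {T : ℝ} (hk : Continuous k) (hkT : ∀ r, T < r → k r = 0) (hΦT : ∀ r, T < r → Φ r = 0)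
    (hΦ : ∀ x : Space N, HasFDerivAt (fun y : Space N => Φ ‖y‖) (k ‖x‖ • innerSL ℝ x) x) :
    ∫ x, Φ ‖x‖ * Laplacian.laplacian u x = - ∫ x, k ‖x‖ * fderiv ℝ u x x := by
  set e := EuclideanSpace.basisFun (Fin N) ℝ with he
  have hΦc : Continuous fun x : Space N => Φ ‖x‖ :=
    continuous_iff_continuousAt.2 fun x => (hΦ x).continuousAt
  have hΦs : HasCompactSupport fun x : Space N => Φ ‖x‖ :=
    HasCompactSupport.intro (isCompact_closedBall 0 T) fun x hx => hΦT _ (by simpa using hx)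
  have hks : HasCompactSupport fun x : Space N => k ‖x‖ :=
    HasCompactSupport.intro (isCompact_closedBall 0 T) fun x hx => hkT _ (by simpa using hx)
  have hkc : Continuous fun x : Space N => k ‖x‖ := hk.comp continuous_norm
  have hfd : ∀ x v, fderiv ℝ (fun y : Space N => Φ ‖y‖) x v = k ‖x‖ * inner ℝ x v := by
    intro x v
    rw [(hΦ x).fderiv]
    simp
  have hu1 : ∀ i, ContDiff ℝ 1 fun y => fderiv ℝ u y (e i) := fun i => contDiff_fderiv_apply hu _
  have hu2 : ∀ i, Continuous fun y => fderiv ℝ (fun y => fderiv ℝ u y (e i)) y (e i) := fun i =>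
    ((hu1 i).continuous_fderiv one_ne_zero).clm_apply continuous_const
  have I1 : ∀ i, Integrable fun x : Space N =>
      Φ ‖x‖ * fderiv ℝ (fun y => fderiv ℝ u y (e i)) x (e i) := fun i =>
    (hΦc.mul (hu2 i)).integrable_of_hasCompactSupport hΦs.mul_right
  have I2 : ∀ i, Integrable fun x : Space N => k ‖x‖ * inner ℝ x (e i) * fderiv ℝ u x (e i) :=
    fun i => ((hkc.mul (by fun_prop)).mul (hu1 i).continuous).integrable_of_hasCompactSupport
      (hks.mul_right.mul_right)
  have I3 : ∀ i, Integrable fun x : Space N => Φ ‖x‖ * fderiv ℝ u x (e i) := fun i =>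
    (hΦc.mul (hu1 i).continuous).integrable_of_hasCompactSupport hΦs.mul_right
  have key : ∀ i, ∫ x : Space N, Φ ‖x‖ * fderiv ℝ (fun y => fderiv ℝ u y (e i)) x (e i) =
      - ∫ x : Space N, k ‖x‖ * inner ℝ x (e i) * fderiv ℝ u x (e i) := by
    intro i
    have := integral_mul_fderiv_eq_neg_fderiv_mul_of_integrable (μ := (volume : Measure (Space N)))
      (f := fun x : Space N => Φ ‖x‖) (g := fun x => fderiv ℝ u x (e i)) (v := e i)
      (by simpa only [hfd] using I2 i) (I1 i) (I3 i) (fun x _ => (hΦ x).differentiableAt)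
      (fun x _ => (hu1 i).differentiable one_ne_zero x)
    simpa only [hfd] using this
  calc ∫ x, Φ ‖x‖ * Laplacian.laplacian u x
      = ∑ i, ∫ x : Space N, Φ ‖x‖ * fderiv ℝ (fun y => fderiv ℝ u y (e i)) x (e i) := by
        rw [← integral_finsetSum _ fun i _ => I1 i]
        congr 1
        ext x
        rw [laplacian_eq_sum hu, Finset.mul_sum]
    _ = - ∑ i, ∫ x : Space N, k ‖x‖ * inner ℝ x (e i) * fderiv ℝ u x (e i) := by
        simp only [key, Finset.sum_neg_distrib]
    _ = _ := by
        rw [← integral_finsetSum _ fun i _ => I2 i]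
        congr 2
        ext x
        rw [← sum_inner_mul_fderiv, Finset.mul_sum]
        simp only [mul_assoc, he]

theorem setIntegral_Ioi_eq_intervalIntegral {f : ℝ → ℝ} {T : ℝ} (hT : 0 ≤ T)
    (hf : ∀ r, T < r → f r = 0) : ∫ r in Ioi (0 : ℝ), f r = ∫ r in 0..T, f r := by
  rw [intervalIntegral.integral_of_le hT]
  refine (setIntegral_eq_of_subset_of_forall_sdiff_eq_zero measurableSet_Ioi
    Ioc_subset_Ioi_self fun x hx => hf x ?_)
  by_contra h
  exact hx.2 ⟨hx.1, not_lt.1 h⟩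

/-- The divergence theorem on balls, tested against a function of the radius. -/
theorem integral_mul_flux_eq_zero [NeZero N] {u : Space N → ℝ} (hu : ContDiff ℝ 2 u) {g : ℝ → ℝ}
    (hg : Continuous g) (hgs : HasCompactSupport g) (hg0 : tsupport g ⊆ Ioi 0) :
    ∫ r, g r * (r ^ (N - 1) * radialDerivAvg u r -
      ∫ s in 0..r, s ^ (N - 1) * avg (Laplacian.laplacian u) s) = 0 := by
  have hgneg : ∀ r, r ≤ 0 → g r = 0 := fun r hr =>
    image_eq_zero_of_notMem_tsupport fun h => absurd (hg0 h) (not_lt.2 hr)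
  obtain ⟨T', hT'⟩ := hgs.isCompact.isBounded.subset_closedBall 0
  set T := max T' 1 with hTdef
  have hT0 : 0 ≤ T := zero_le_one.trans (le_max_right _ _)
  have hgT : ∀ r, T < r → g r = 0 := fun r hr => image_eq_zero_of_notMem_tsupport fun h => by
    have h1 := hT' h
    rw [mem_closedBall_zero_iff, Real.norm_eq_abs, abs_le] at h1
    exact absurd (h1.2.trans (le_max_left T' 1)) (not_le.2 hr)
  have hnear : ∀ᶠ r in nhds (0 : ℝ), g r = 0 := by
    have : (tsupport g)ᶜ ∈ nhds (0 : ℝ) :=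
      (isClosed_tsupport g).isOpen_compl.mem_nhds fun h => lt_irrefl (0 : ℝ) (hg0 h)
    filter_upwards [this] with r hr using image_eq_zero_of_notMem_tsupport hr
  -- The primitive of `g` vanishing beyond `T` makes `Φ ‖x‖` a compactly supported test function,
  -- constant near the origin; its radial derivative `g` then weights the flux.
  set Φ : ℝ → ℝ := fun r => ∫ s in T..r, g s with hΦdef
  have hΦd : ∀ r, HasDerivAt Φ (g r) r := fun r =>
    intervalIntegral.integral_hasDerivAt_right (hg.intervalIntegrable _ _)
      hg.stronglyMeasurable.stronglyMeasurableAtFilter hg.continuousAt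
  have hΦT : ∀ r, T < r → Φ r = 0 := by
    intro r hr
    refine intervalIntegral.integral_zero_ae (Eventually.of_forall fun s hs => hgT s ?_)
    rw [uIoc_of_le hr.le] at hs
    exact hs.1
  -- The gradient of `Φ ‖x‖` is `k ‖x‖ x`. Dividing by `r` is harmless because `g` vanishes near
  -- `0`.
  set k : ℝ → ℝ := fun r => r⁻¹ * g r with hkdef
  have hk : Continuous k := by
    refine continuous_iff_continuousAt.2 fun r => ?_
    rcases eq_or_ne r 0 with rfl | hr
    · have : k =ᶠ[nhds 0] fun _ => 0 := hnear.mono fun s hs => by simp [hkdef, hs]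
      exact continuousAt_const.congr this.symm
    · exact (continuousAt_inv₀ hr).mul hg.continuousAt
  have hΦF : ∀ x : Space N, HasFDerivAt (fun y : Space N => Φ ‖y‖) (k ‖x‖ • innerSL ℝ x) x := by
    intro x
    rcases eq_or_ne x 0 with rfl | hx
    · obtain ⟨ε, hε, hball⟩ := Metric.eventually_nhds_iff_ball.1 hnear
      have hev : (fun y : Space N => Φ ‖y‖) =ᶠ[nhds 0] fun _ => Φ 0 := by
        filter_upwards [Metric.ball_mem_nhds (0 : Space N) hε] with y hy
        have hadd := intervalIntegral.integral_add_adjacent_intervals (μ := volume)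
          (hg.intervalIntegrable T 0) (hg.intervalIntegrable 0 ‖y‖)
        have hz : ∫ s in 0..‖y‖, g s = 0 := by
          refine intervalIntegral.integral_zero_ae (Eventually.of_forall fun s hs => hball s ?_)
          rw [uIoc_of_le (norm_nonneg _)] at hs
          rw [mem_ball_zero_iff] at hy ⊢
          rw [Real.norm_of_nonneg hs.1.le]
          exact hs.2.trans_lt hy
        simp only [hΦdef]
        linarith
      have : k ‖(0 : Space N)‖ • innerSL ℝ (0 : Space N) = (0 : Space N →L[ℝ] ℝ) := by simp
      rw [this]
      exact (hasFDerivAt_const _ _).congr_of_eventuallyEq hev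
    · have := (hΦd ‖x‖).comp_hasFDerivAt x (hasFDerivAt_norm hx)
      refine this.congr_fderiv ?_
      simp only [hkdef, smul_smul, mul_comm]
  have hkT : ∀ r, T < r → k r = 0 := fun r hr => by simp [hkdef, hgT r hr]
  have hparts := integral_radial_mul_laplacian hu hk hkT hΦT hΦF
  have hΦc : Continuous fun x : Space N => Φ ‖x‖ :=
    continuous_iff_continuousAt.2 fun x => (hΦF x).continuousAt
  have hLc := continuous_laplacian hu
  have hu1 := hu.continuous_fderiv two_ne_zero
  have hF1 : Integrable fun x : Space N => Φ ‖x‖ * Laplacian.laplacian u x :=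
    (hΦc.mul hLc).integrable_of_hasCompactSupport (HasCompactSupport.mul_right
      (HasCompactSupport.intro (isCompact_closedBall 0 T) fun x hx => hΦT _ (by simpa using hx)))
  have hF2 : Integrable fun x : Space N => k ‖x‖ * fderiv ℝ u x x :=
    ((hk.comp continuous_norm).mul (hu1.clm_apply continuous_id)).integrable_of_hasCompactSupport
      (HasCompactSupport.mul_right
      (HasCompactSupport.intro (isCompact_closedBall 0 T) fun x hx => hkT _ (by simpa using hx)))
  rw [integral_polar hF1, integral_polar hF2, ← mul_neg] at hparts
  have hne : (unitSphereMeasure N).real univ ≠ 0 :=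
    (measureReal_ne_zero_iff (measure_ne_top _ _)).2
      (Measure.measure_univ_ne_zero.2 (NeZero.ne _))
  have hparts := mul_left_cancel₀ hne hparts
  set L : ℝ → ℝ := avg (Laplacian.laplacian u) with hL
  have hLcont : Continuous L := continuous_avg hLc
  have hnorm : ∀ r : ℝ, 0 < r → ∀ θ : Metric.sphere (0 : Space N) 1, ‖r • (θ : Space N)‖ = r := by
    intro r hr θ
    simp [norm_smul, abs_of_pos hr]
  have e1 : ∀ r ∈ Ioi (0 : ℝ), r ^ (N - 1) * avg (fun x => Φ ‖x‖ * Laplacian.laplacian u x) r =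
      Φ r * (r ^ (N - 1) * L r) := by
    intro r hr
    simp only [avg, hnorm r hr, hL]
    rw [integral_const_mul]
    ring
  have e2 : ∀ r ∈ Ioi (0 : ℝ), r ^ (N - 1) * avg (fun x => k ‖x‖ * fderiv ℝ u x x) r =
      g r * (r ^ (N - 1) * radialDerivAvg u r) := by
    intro r hr
    have hr0 : r ≠ 0 := (ne_of_gt hr)
    simp only [avg, hnorm r hr, radialDerivAvg, map_smul, smul_eq_mul, hkdef]
    rw [integral_const_mul, integral_const_mul]
    field_simp
  rw [setIntegral_congr_fun measurableSet_Ioi e1, setIntegral_congr_fun measurableSet_Ioi e2,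
    setIntegral_Ioi_eq_intervalIntegral hT0 (fun r hr => by simp [hΦT r hr]),
    setIntegral_Ioi_eq_intervalIntegral hT0 (fun r hr => by simp [hgT r hr])] at hparts
  set E : ℝ → ℝ := fun r => ∫ s in 0..r, s ^ (N - 1) * L s with hE
  have hwc : Continuous fun s : ℝ => s ^ (N - 1) * L s := by fun_prop
  have hEd : ∀ r, HasDerivAt E (r ^ (N - 1) * L r) r := fun r =>
    intervalIntegral.integral_hasDerivAt_right (hwc.intervalIntegrable _ _)
      hwc.stronglyMeasurable.stronglyMeasurableAtFilter hwc.continuousAt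
  have hEc : Continuous E := continuous_iff_continuousAt.2 fun r => (hEd r).continuousAt
  -- A second integration by parts, now in the radius, turns `Φ` into `g` on the Laplacian side.
  -- Both boundary terms vanish, since `Φ T = 0` and `E 0 = 0`.
  have hip := intervalIntegral.integral_mul_deriv_eq_deriv_mul (a := 0) (b := T)
    (fun r _ => hΦd r) (fun r _ => hEd r) (hg.intervalIntegrable _ _) (hwc.intervalIntegrable _ _)
  have hΦTT : Φ T = 0 := intervalIntegral.integral_same
  have hE0 : E 0 = 0 := intervalIntegral.integral_same
  rw [hΦTT, hE0, hparts] at hip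
  have hDc : Continuous (radialDerivAvg u) := continuous_radialDerivAvg (hu.of_le (by norm_num))
  have hsplit : ∫ r, g r * (r ^ (N - 1) * radialDerivAvg u r - E r) =
      ∫ r in 0..T, g r * (r ^ (N - 1) * radialDerivAvg u r - E r) := by
    rw [← setIntegral_Ioi_eq_intervalIntegral hT0 (fun r hr => by simp [hgT r hr])]
    refine (setIntegral_eq_integral_of_forall_compl_eq_zero fun r hr => ?_).symm
    rw [hgneg r (not_lt.1 hr), zero_mul]
  rw [hsplit]
  simp only [mul_sub]
  rw [intervalIntegral.integral_sub (Continuous.intervalIntegrable (by fun_prop) _ _)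
    (Continuous.intervalIntegrable (by fun_prop) _ _)]
  linarith

/-- The divergence theorem on balls. -/
theorem pow_mul_radialDerivAvg [NeZero N] {u : Space N → ℝ} (hu : ContDiff ℝ 2 u) {r : ℝ}
    (hr : 0 < r) : r ^ (N - 1) * radialDerivAvg u r =
      ∫ s in 0..r, s ^ (N - 1) * avg (Laplacian.laplacian u) s := by
  have hDc : Continuous (radialDerivAvg u) := continuous_radialDerivAvg (hu.of_le (by norm_num))
  have hLc := continuous_avg (continuous_laplacian hu)
  have hEc : Continuous fun r : ℝ => ∫ s in 0..r, s ^ (N - 1) * avg (Laplacian.laplacian u) s :=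
    intervalIntegral.continuous_primitive
      (fun a b => Continuous.intervalIntegrable (by fun_prop) _ _) _
  have hGc : Continuous fun r : ℝ => r ^ (N - 1) * radialDerivAvg u r -
      ∫ s in 0..r, s ^ (N - 1) * avg (Laplacian.laplacian u) s := by fun_prop
  -- Fundamental lemma of the calculus of variations; continuity then upgrades almost everywhere to
  -- everywhere on `(0, ∞)`.
  have hae := isOpen_Ioi.ae_eq_zero_of_integral_contDiff_smul_eq_zero (U := Ioi (0 : ℝ))
    (hGc.locallyIntegrable.locallyIntegrableOn _) (μ := volume)
    fun g hg hgs hg0 => integral_mul_flux_eq_zero hu hg.continuous hgs hg0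
  have := Measure.eqOn_open_of_ae_eq (μ := volume) (U := Ioi (0 : ℝ)) (g := fun _ => (0 : ℝ))
    ((ae_restrict_iff' measurableSet_Ioi).2 hae) isOpen_Ioi hGc.continuousOn continuousOn_const hr
  exact sub_eq_zero.1 this

/-! ### Growth inequalities for the spherical means. -/

/-- The kernel splits as `∫ s L - r^(-(k+1)) ∫ s^(k+2) L`, and on differentiation the two terms
containing `L r` cancel. Used with `k = N - 3`, where the derivative is a flux divided by `r^(N-1)`.
-/
theorem integral_radialKernel_hasDerivAt {k : ℕ} {L : ℝ → ℝ} (hL : Continuous L) (r₀ : ℝ) {r : ℝ}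
    (hr : 0 < r) :
    HasDerivAt (fun r => 1 / ((k : ℝ) + 1) * ∫ s in r₀..r, s * (1 - (s / r) ^ (k + 1)) * L s)
      ((r ^ (k + 2))⁻¹ * ∫ s in r₀..r, s ^ (k + 2) * L s) r := by
  have hc1 : Continuous fun s : ℝ => s * L s := by fun_prop
  have hc2 : Continuous fun s : ℝ => s ^ (k + 2) * L s := by fun_prop
  have h1 : HasDerivAt (fun r => ∫ s in r₀..r, s * L s) (r * L r) r :=
    intervalIntegral.integral_hasDerivAt_right (hc1.intervalIntegrable _ _)
      hc1.stronglyMeasurable.stronglyMeasurableAtFilter hc1.continuousAt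
  have h2 : HasDerivAt (fun r => ∫ s in r₀..r, s ^ (k + 2) * L s) (r ^ (k + 2) * L r) r :=
    intervalIntegral.integral_hasDerivAt_right (hc2.intervalIntegrable _ _)
      hc2.stronglyMeasurable.stronglyMeasurableAtFilter hc2.continuousAt
  have h3 : HasDerivAt (fun r : ℝ => (r ^ (k + 1))⁻¹)
      (-(((k + 1 : ℕ) : ℝ) * r ^ k) / (r ^ (k + 1)) ^ 2) r := by
    exact (hasDerivAt_pow (k + 1) r).fun_inv (pow_ne_zero _ hr.ne')
  have h4 := (h1.sub (h3.mul h2)).const_mul (1 / ((k : ℝ) + 1))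
  have heq : ∀ r : ℝ, ∫ s in r₀..r, s * (1 - (s / r) ^ (k + 1)) * L s =
      (∫ s in r₀..r, s * L s) - (r ^ (k + 1))⁻¹ * ∫ s in r₀..r, s ^ (k + 2) * L s := by
    intro r
    rw [← intervalIntegral.integral_const_mul, ← intervalIntegral.integral_sub
      (hc1.intervalIntegrable _ _) ((hc2.const_mul _).intervalIntegrable _ _)]
    refine intervalIntegral.integral_congr fun s _ => ?_
    simp only [div_pow]
    ring
  simp only [heq]
  refine h4.congr_deriv ?_
  have hk : (k : ℝ) + 1 ≠ 0 := by positivity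
  push_cast
  field_simp
  ring

/-- Growth of the spherical means of a function with nonnegative Laplacian. -/
theorem avg_add_integral_le (hN : 3 ≤ N) {u : Space N → ℝ} (hu : ContDiff ℝ 2 u)
    (hΔ : ∀ x, 0 ≤ Laplacian.laplacian u x) {r₀ r : ℝ} (hr₀ : 0 < r₀) (hr : r₀ ≤ r) :
    avg u r₀ + 1 / ((N : ℝ) - 2) * ∫ s in r₀..r,
      s * (1 - (s / r) ^ (N - 2)) * avg (Laplacian.laplacian u) s ≤ avg u r := by
  obtain ⟨k, rfl⟩ := Nat.exists_eq_add_of_le' hN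
  have : NeZero (k + 3) := ⟨by omega⟩
  have hL := continuous_avg (continuous_laplacian hu)
  have hL0 := avg_nonneg hΔ
  set L := avg (Laplacian.laplacian u) with hLdef
  have hcast : ((k + 3 : ℕ) : ℝ) - 2 = (k : ℝ) + 1 := by push_cast; ring
  have hsub : k + 3 - 2 = k + 1 := rfl
  rw [hcast, hsub]
  set K : ℝ → ℝ := fun r =>
    1 / ((k : ℝ) + 1) * ∫ s in r₀..r, s * (1 - (s / r) ^ (k + 1)) * L s with hK
  have hd : ∀ s, 0 < s → HasDerivAt (fun r => avg u r - K r)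
      (radialDerivAvg u s - (s ^ (k + 2))⁻¹ * ∫ t in r₀..s, t ^ (k + 2) * L t) s := fun s hs =>
    (hasDerivAt_avg (hu.of_le (by norm_num)) s).sub (integral_radialKernel_hasDerivAt hL r₀ hs)
  -- By the divergence theorem the derivative of this difference at `s` is `s^(-(N-1))` times
  -- `∫_0^{r₀} t^(N-1) L t`, which is nonnegative.
  have hmono : MonotoneOn (fun r => avg u r - K r) (Icc r₀ r) := by
    refine monotoneOn_of_deriv_nonneg (convex_Icc _ _)
      (fun s hs => (hd s (hr₀.trans_le hs.1)).continuousAt.continuousWithinAt) ?_ ?_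
    · intro s hs
      rw [interior_Icc] at hs
      exact (hd s (hr₀.trans hs.1)).differentiableAt.differentiableWithinAt
    · intro s hs
      rw [interior_Icc] at hs
      have hs0 : 0 < s := hr₀.trans hs.1
      rw [(hd s hs0).deriv]
      have hG : s ^ (k + 2) * radialDerivAvg u s = ∫ t in 0..s, t ^ (k + 2) * L t :=
        pow_mul_radialDerivAvg hu hs0
      have hc2 : Continuous fun s : ℝ => s ^ (k + 2) * L s := by fun_prop
      have hadd := intervalIntegral.integral_add_adjacent_intervals (μ := volume)
        (hc2.intervalIntegrable 0 r₀) (hc2.intervalIntegrable r₀ s)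
      have hnn : 0 ≤ ∫ t in 0..r₀, t ^ (k + 2) * L t :=
        intervalIntegral.integral_nonneg hr₀.le fun t ht => mul_nonneg (pow_nonneg ht.1 _) (hL0 t)
      rw [sub_nonneg, inv_mul_le_iff₀ (by positivity)]
      linarith
  have h := hmono (left_mem_Icc.2 hr) (right_mem_Icc.2 hr) hr
  have hK0 : K r₀ = 0 := by simp [hK]
  simp only [hK0] at h
  linarith

/-- `U` grows at least as the radial solution of `ΔU = f W^γ`. -/
def RadialGrowth (N : ℕ) (f : ℝ → ℝ) (γ : ℝ) (W U : ℝ → ℝ) : Prop :=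
  ∀ r₀ r, 0 < r₀ → r₀ ≤ r →
    U r₀ + 1 / ((N : ℝ) - 2) * ∫ s in r₀..r, s * f s * (1 - (s / r) ^ (N - 2)) * W s ^ γ ≤ U r

theorem radialGrowth_avg (hN : 3 ≤ N) {α : ℝ} (hα : 1 ≤ α) {p u v : Space N → ℝ}
    (hp : Continuous p) (hp0 : ∀ x, 0 ≤ p x) (hu : ContDiff ℝ 2 u) (hv : Continuous v)
    (hv0 : ∀ x, 0 ≤ v x) (hΔ : ∀ x, Laplacian.laplacian u x = p x * v x ^ α) :
    RadialGrowth N (radialWeight α p) α (avg v) (avg u) := by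
  intro r₀ r hr₀ hr
  have : NeZero N := ⟨by omega⟩
  have hN2 : (0 : ℝ) < (N : ℝ) - 2 := by
    have : (3 : ℝ) ≤ N := by exact_mod_cast hN
    linarith
  refine le_trans ?_ (avg_add_integral_le hN hu
    (fun x => by rw [hΔ]; exact mul_nonneg (hp0 x) (Real.rpow_nonneg (hv0 x) _)) hr₀ hr)
  have hL := continuous_avg (continuous_laplacian hu)
  gcongr
  have hk : ∀ s ∈ Ioc r₀ r, 0 ≤ s ∧ 0 ≤ 1 - (s / r) ^ (N - 2) := by
    intro s hs
    have hs0 : 0 < s := hr₀.trans hs.1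
    refine ⟨hs0.le, sub_nonneg.2 (pow_le_one₀ (div_nonneg hs0.le (hs0.le.trans hs.2)) ?_)⟩
    exact div_le_one_of_le₀ hs.2 (hs0.le.trans hs.2)
  rw [intervalIntegral.integral_of_le hr, intervalIntegral.integral_of_le hr]
  -- Only the majorant has to be integrable: a nonintegrable minorant would have Bochner integral
  -- `0`. No regularity of the radial weight is needed here.
  refine integral_mono_of_nonneg ?_ ?_ ?_
  · filter_upwards [ae_restrict_mem measurableSet_Ioc] with s hs
    exact mul_nonneg (mul_nonneg (mul_nonneg (hk s hs).1 (radialWeight_nonneg hp0 s)) (hk s hs).2)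
      (Real.rpow_nonneg (avg_nonneg hv0 s) _)
  · exact (Continuous.intervalIntegrable (by fun_prop) _ _).1
  · filter_upwards [ae_restrict_mem measurableSet_Ioc] with s hs
    have h1 := radialWeight_mul_avg_rpow_le hα hp hv hp0 hv0 (hk s hs).1
    have h2 : avg (Laplacian.laplacian u) s = avg (fun x => p x * v x ^ α) s := by
      congr 1
      exact funext hΔ
    rw [← h2] at h1
    calc s * radialWeight α p s * (1 - (s / r) ^ (N - 2)) * avg v s ^ α
        = s * (1 - (s / r) ^ (N - 2)) * (radialWeight α p s * avg v s ^ α) := by ring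
      _ ≤ _ := mul_le_mul_of_nonneg_left h1 (mul_nonneg (hk s hs).1 (hk s hs).2)

theorem zpow_one_sub_mul_pow {m : ℕ} (hm : 1 ≤ m) {r : ℝ} (hr : r ≠ 0) :
    r ^ (1 - (m : ℤ)) * r ^ (m - 1) = 1 := by
  rw [← zpow_natCast, ← zpow_add₀ hr, Nat.cast_sub hm]
  simp

theorem pow_mul_zpow_one_sub_mul {m : ℕ} (hm : 1 ≤ m) {r : ℝ} (hr : r ≠ 0) (x : ℝ) :
    r ^ (m - 1) * (r ^ (1 - (m : ℤ)) * x) = x := by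
  rw [← mul_assoc, mul_comm (r ^ (m - 1)), zpow_one_sub_mul_pow hm hr, one_mul]

/-- Measurability comes from monotonicity of `r^(1-m) p̃`, and boundedness from the reverse Hölder
inequality with `w = 1`, which gives `p̃ ≤ avg p`. -/
theorem intervalIntegrable_radialWeight [NeZero N] {α : ℝ} (hα : 1 ≤ α) {p : Space N → ℝ}
    (hp : Continuous p) (hp0 : ∀ x, 0 ≤ p x) {m : ℕ} (hm : 1 ≤ m) {ρ : ℝ} (hρ : 0 < ρ)
    (hmono : AntitoneOn (fun r : ℝ => r ^ (1 - (m : ℤ)) * radialWeight α p r) (Ioi ρ))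
    {a b : ℝ} (ha : ρ ≤ a) (hab : a ≤ b) :
    IntervalIntegrable (radialWeight α p) volume a b := by
  rw [intervalIntegrable_iff_integrableOn_Ioc_of_le hab]
  have hmeas : AEStronglyMeasurable (radialWeight α p) (volume.restrict (Ioi ρ)) := by
    have h1 : AEMeasurable (fun r : ℝ => r ^ (m - 1) * (r ^ (1 - (m : ℤ)) * radialWeight α p r))
        (volume.restrict (Ioi ρ)) :=
      (measurable_id.pow_const _).aemeasurable.mul
        (aemeasurable_restrict_of_antitoneOn measurableSet_Ioi hmono)
    refine (h1.congr ?_).aestronglyMeasurable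
    filter_upwards [ae_restrict_mem measurableSet_Ioi] with r hr
    exact pow_mul_zpow_one_sub_mul hm (hρ.trans hr).ne' _
  have hint : IntegrableOn (avg p) (Ioc a b) :=
    ((continuous_avg hp).intervalIntegrable a b).1
  refine Integrable.mono' hint (hmeas.mono_measure (Measure.restrict_mono
    (fun x hx => ha.trans_lt hx.1) le_rfl)) ?_
  filter_upwards [ae_restrict_mem measurableSet_Ioc] with r hr
  rw [Real.norm_of_nonneg (radialWeight_nonneg hp0 r)]
  simpa [avg_const_one] using radialWeight_mul_avg_rpow_le hα hp continuous_const hp0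
    (w := fun _ => 1) (fun _ => zero_le_one) (hρ.le.trans (ha.trans hr.1.le))

/-! ### A scale-invariant Hölder inequality with a Beta weight. -/

/-- At least one of `t - τ` and `τ - s` is no smaller than half of `t - s`, so at most one singular
factor survives at each point. -/
theorem rpow_neg_mul_rpow_neg_le {e₁ e₂ s t τ : ℝ} (h₁ : 0 < e₁) (h₂ : 0 < e₂) (hs : s < τ)
    (ht : τ < t) :
    (t - τ) ^ (-e₁) * (τ - s) ^ (-e₂) ≤
      ((t - s) / 2) ^ (-e₁) * (τ - s) ^ (-e₂) + ((t - s) / 2) ^ (-e₂) * (t - τ) ^ (-e₁) := by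
  have p1 : 0 < τ - s := sub_pos.2 hs
  have p2 : 0 < t - τ := sub_pos.2 ht
  have p3 : 0 < (t - s) / 2 := by linarith
  have q1 : 0 ≤ ((t - s) / 2) ^ (-e₁) * (τ - s) ^ (-e₂) := by positivity
  have q2 : 0 ≤ ((t - s) / 2) ^ (-e₂) * (t - τ) ^ (-e₁) := by positivity
  rcases le_total ((t - s) / 2) (t - τ) with h | h
  · have := Real.rpow_le_rpow_of_nonpos p3 h (neg_nonpos.2 h₁.le)
    have := mul_le_mul_of_nonneg_right this (Real.rpow_nonneg p1.le (-e₂))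
    linarith
  · have h' : (t - s) / 2 ≤ τ - s := by linarith
    have := Real.rpow_le_rpow_of_nonpos p3 h' (neg_nonpos.2 h₂.le)
    have := mul_le_mul_of_nonneg_left this (Real.rpow_nonneg p2.le (-e₁))
    linarith [mul_comm (((t - s) / 2) ^ (-e₂)) ((t - τ) ^ (-e₁))]

theorem intervalIntegrable_sub_right_rpow {e s t : ℝ} (he : e < 1) :
    IntervalIntegrable (fun τ : ℝ => (τ - s) ^ (-e)) volume s t := by
  have h := (intervalIntegral.intervalIntegrable_rpow' (a := 0) (b := t - s) (r := -e)
    (by linarith)).comp_sub_right s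
  simpa using h

theorem intervalIntegrable_sub_left_rpow {e s t : ℝ} (he : e < 1) :
    IntervalIntegrable (fun τ : ℝ => (t - τ) ^ (-e)) volume s t := by
  have h := ((intervalIntegral.intervalIntegrable_rpow' (a := 0) (b := t - s) (r := -e)
    (by linarith)).comp_sub_left t).symm
  simpa using h

theorem integral_sub_right_rpow {e s t : ℝ} (he : e < 1) :
    ∫ τ in s..t, (τ - s) ^ (-e) = (t - s) ^ (1 - e) / (1 - e) := by
  rw [intervalIntegral.integral_comp_sub_right (fun x : ℝ => x ^ (-e)), sub_self,
    integral_rpow (Or.inl (by linarith)), Real.zero_rpow (by linarith)]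
  ring_nf

theorem integral_sub_left_rpow {e s t : ℝ} (he : e < 1) :
    ∫ τ in s..t, (t - τ) ^ (-e) = (t - s) ^ (1 - e) / (1 - e) := by
  rw [intervalIntegral.integral_comp_sub_left (fun x : ℝ => x ^ (-e)), sub_self,
    integral_rpow (Or.inl (by linarith)), Real.zero_rpow (by linarith)]
  ring_nf

/-- A scale invariant bound for the Beta integral of total order one. -/
theorem integrableOn_betaKernel_and_le {e₁ e₂ s t : ℝ} (h₁ : 0 < e₁) (h₂ : 0 < e₂)
    (h : e₁ + e₂ = 1) (hst : s < t) :
    IntegrableOn (fun τ : ℝ => (t - τ) ^ (-e₁) * (τ - s) ^ (-e₂)) (Ioo s t) ∧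
    ∫ τ in Ioo s t, (t - τ) ^ (-e₁) * (τ - s) ^ (-e₂) ≤ 2 ^ e₁ / e₁ + 2 ^ e₂ / e₂ := by
  have i1 := (intervalIntegrable_sub_right_rpow (s := s) (t := t) (e := e₂) (by linarith)).const_mul
    (((t - s) / 2) ^ (-e₁))
  have i2 := (intervalIntegrable_sub_left_rpow (s := s) (t := t) (e := e₁) (by linarith)).const_mul
    (((t - s) / 2) ^ (-e₂))
  have i3 := ((intervalIntegrable_iff_integrableOn_Ioc_of_le hst.le).1 (i1.add i2)).mono_set
    Ioo_subset_Ioc_self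
  have hle : ∀ᵐ τ ∂(volume.restrict (Ioo s t)), (t - τ) ^ (-e₁) * (τ - s) ^ (-e₂) ≤
      ((t - s) / 2) ^ (-e₁) * (τ - s) ^ (-e₂) + ((t - s) / 2) ^ (-e₂) * (t - τ) ^ (-e₁) := by
    filter_upwards [ae_restrict_mem measurableSet_Ioo] with τ hτ
    exact rpow_neg_mul_rpow_neg_le h₁ h₂ hτ.1 hτ.2
  have hnn : ∀ᵐ τ ∂(volume.restrict (Ioo s t)), 0 ≤ (t - τ) ^ (-e₁) * (τ - s) ^ (-e₂) := by
    filter_upwards [ae_restrict_mem measurableSet_Ioo] with τ hτ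
    exact mul_nonneg (Real.rpow_nonneg (sub_pos.2 hτ.2).le _)
      (Real.rpow_nonneg (sub_pos.2 hτ.1).le _)
  refine ⟨Integrable.mono' i3 ?_ ?_, (integral_mono_of_nonneg hnn i3 hle).trans ?_⟩
  · exact (Measurable.mul ((measurable_const.sub measurable_id).pow_const _)
      ((measurable_id.sub measurable_const).pow_const _)).aestronglyMeasurable
  · filter_upwards [hle, hnn] with τ hτ hτ'
    rwa [Real.norm_of_nonneg hτ']
  · rw [← integral_Ioc_eq_integral_Ioo, ← intervalIntegral.integral_of_le hst.le,
      intervalIntegral.integral_add i1 i2, intervalIntegral.integral_const_mul,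
      intervalIntegral.integral_const_mul, integral_sub_right_rpow (by linarith),
      integral_sub_left_rpow (by linarith)]
    have hT : 0 < t - s := sub_pos.2 hst
    have e1 : 1 - e₂ = e₁ := by linarith
    have e2 : 1 - e₁ = e₂ := by linarith
    -- The powers of `t - s` cancel because the two exponents add up to one; this is the scale
    -- invariance.
    have key : ∀ e : ℝ, ((t - s) / 2) ^ (-e) * ((t - s) ^ e / e) = 2 ^ e / e := by
      intro e
      rw [Real.rpow_neg (by positivity), Real.div_rpow hT.le zero_le_two]
      have : (t - s) ^ e ≠ 0 := (Real.rpow_pos_of_pos hT _).ne'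
      have : (2 : ℝ) ^ e ≠ 0 := (Real.rpow_pos_of_pos two_pos _).ne'
      field_simp
    rw [e1, e2, key, key]

/-- The constant in `integral_le_betaWeight`. -/
def betaConst (μ κ : ℝ) : ℝ :=
  (2 ^ (μ / (μ + κ)) / (μ / (μ + κ)) + 2 ^ (κ / (μ + κ)) / (κ / (μ + κ))) ^
    ((μ + κ) / (μ + κ + 1))

theorem betaConst_nonneg {μ κ : ℝ} (hμ : 0 < μ) (hκ : 0 < κ) : 0 ≤ betaConst μ κ := by
  unfold betaConst; positivity

/-- Hölder's inequality with the weight `(t-τ)^μ (τ-s)^κ`; the constant is scale invariant. -/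
theorem integral_le_betaWeight {μ κ s t : ℝ} (hμ : 0 < μ) (hκ : 0 < κ) (hst : s < t) {h : ℝ → ℝ}
    (hh0 : ∀ τ ∈ Ioo s t, 0 ≤ h τ) (hhm : AEStronglyMeasurable h (volume.restrict (Ioo s t)))
    (hint : IntegrableOn (fun τ => (t - τ) ^ μ * (τ - s) ^ κ * h τ ^ (μ + κ + 1)) (Ioo s t)) :
    ∫ τ in Ioo s t, h τ ≤ betaConst μ κ *
      (∫ τ in Ioo s t, (t - τ) ^ μ * (τ - s) ^ κ * h τ ^ (μ + κ + 1)) ^ (1 / (μ + κ + 1)) := by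
  set σ := μ + κ + 1 with hσ
  have hσ1 : 1 < σ := by linarith
  have hσ0 : 0 < σ := by linarith
  have hconj : σ.HolderConjugate (σ / (σ - 1)) := Real.HolderConjugate.conjExponent hσ1
  set w : ℝ → ℝ := fun τ => (t - τ) ^ μ * (τ - s) ^ κ with hw
  have hwpos : ∀ τ ∈ Ioo s t, 0 < w τ := fun τ hτ =>
    mul_pos (Real.rpow_pos_of_pos (sub_pos.2 hτ.2) _) (Real.rpow_pos_of_pos (sub_pos.2 hτ.1) _)
  have hwm : Measurable w := Measurable.mul ((measurable_const.sub measurable_id).pow_const _)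
      ((measurable_id.sub measurable_const).pow_const _)
  -- Hölder is applied to `h = (w^(1/σ) h) · w^(-1/σ)`. Since `σ - 1 = μ + κ`, the dual power of the
  -- second factor is the Beta kernel with exponents `μ/(μ+κ)` and `κ/(μ+κ)`, of sum one.
  set F : ℝ → ℝ := fun τ => w τ ^ (1 / σ) * h τ with hF
  set G : ℝ → ℝ := fun τ => w τ ^ (-(1 / σ)) with hG
  have hF0 : ∀ τ ∈ Ioo s t, 0 ≤ F τ := fun τ hτ =>
    mul_nonneg (Real.rpow_nonneg (hwpos τ hτ).le _) (hh0 τ hτ)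
  have hG0 : ∀ τ ∈ Ioo s t, 0 ≤ G τ := fun τ hτ => Real.rpow_nonneg (hwpos τ hτ).le _
  have hFσ : ∀ τ ∈ Ioo s t, F τ ^ σ = w τ * h τ ^ σ := by
    intro τ hτ
    rw [hF, Real.mul_rpow (Real.rpow_nonneg (hwpos τ hτ).le _) (hh0 τ hτ),
      ← Real.rpow_mul (hwpos τ hτ).le, one_div_mul_cancel hσ0.ne', Real.rpow_one]
  have hsum : μ / (μ + κ) + κ / (μ + κ) = 1 := by field_simp
  have hGq : ∀ τ ∈ Ioo s t, G τ ^ (σ / (σ - 1)) =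
      (t - τ) ^ (-(μ / (μ + κ))) * (τ - s) ^ (-(κ / (μ + κ))) := by
    intro τ hτ
    have p1 : 0 < t - τ := sub_pos.2 hτ.2
    have p2 : 0 < τ - s := sub_pos.2 hτ.1
    have hs1 : σ - 1 = μ + κ := by rw [hσ]; ring
    rw [hG, ← Real.rpow_mul (hwpos τ hτ).le, hw, hs1,
      Real.mul_rpow (Real.rpow_nonneg p1.le _) (Real.rpow_nonneg p2.le _),
      ← Real.rpow_mul p1.le, ← Real.rpow_mul p2.le]
    congr 2 <;> field_simp
  obtain ⟨hβi, hβ⟩ := integrableOn_betaKernel_and_le (div_pos hμ (add_pos hμ hκ))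
    (div_pos hκ (add_pos hμ hκ)) hsum hst
  have hFm : MemLp F (ENNReal.ofReal σ) (volume.restrict (Ioo s t)) := by
    have hFs : AEStronglyMeasurable F (volume.restrict (Ioo s t)) :=
      (hwm.pow_const _).aestronglyMeasurable.mul hhm
    rw [← integrable_norm_rpow_iff hFs (by simpa using hσ0) ENNReal.ofReal_ne_top, ENNReal.toReal_ofReal hσ0.le]
    refine Integrable.congr hint ?_
    filter_upwards [ae_restrict_mem measurableSet_Ioo] with τ hτ
    rw [Real.norm_of_nonneg (hF0 τ hτ), hFσ τ hτ]
  have hGm : MemLp G (ENNReal.ofReal (σ / (σ - 1))) (volume.restrict (Ioo s t)) := by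
    have hGs : AEStronglyMeasurable G (volume.restrict (Ioo s t)) :=
      (hwm.pow_const _).aestronglyMeasurable
    rw [← integrable_norm_rpow_iff hGs (by simpa using hconj.symm.pos) ENNReal.ofReal_ne_top,
      ENNReal.toReal_ofReal hconj.symm.pos.le]
    refine Integrable.congr hβi ?_
    filter_upwards [ae_restrict_mem measurableSet_Ioo] with τ hτ
    rw [Real.norm_of_nonneg (hG0 τ hτ), hGq τ hτ]
  have key := integral_mul_le_Lp_mul_Lq_of_nonneg hconj
    ((ae_restrict_iff' measurableSet_Ioo).2 (Eventually.of_forall hF0))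
    ((ae_restrict_iff' measurableSet_Ioo).2 (Eventually.of_forall hG0)) hFm hGm
  have hFG : ∀ τ ∈ Ioo s t, F τ * G τ = h τ := by
    intro τ hτ
    rw [hF, hG]
    simp only
    rw [mul_right_comm, ← Real.rpow_add (hwpos τ hτ)]
    simp
  rw [setIntegral_congr_fun measurableSet_Ioo hFG, setIntegral_congr_fun measurableSet_Ioo hFσ,
    setIntegral_congr_fun measurableSet_Ioo hGq] at key
  refine key.trans ?_
  rw [mul_comm]
  refine mul_le_mul_of_nonneg_right ?_ (Real.rpow_nonneg (setIntegral_nonneg measurableSet_Ioo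
    fun τ hτ => mul_nonneg (hwpos τ hτ).le (Real.rpow_nonneg (hh0 τ hτ) _)) _)
  have he : 1 / (σ / (σ - 1)) = (μ + κ) / (μ + κ + 1) := by rw [hσ]; simp
  rw [he, betaConst]
  refine Real.rpow_le_rpow (setIntegral_nonneg measurableSet_Ioo fun τ hτ => mul_nonneg
    (Real.rpow_nonneg (sub_pos.2 hτ.2).le _) (Real.rpow_nonneg (sub_pos.2 hτ.1).le _)) hβ
    (by positivity)

/-! ### Summation over doublings of an increasing function. -/

/-- Where `U` at most doubles, the growing factor `U d ^ η` costs only `2 ^ η` and merges with the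
negative power at `c`. -/
theorem integral_le_of_le_two_mul {U h : ℝ → ℝ} {C η ε c d : ℝ} (hη : 0 < η) (hC : 0 ≤ C)
    (hcd : c ≤ d) (hUcd : U c ≤ U d) (hUpos : 0 < U c)
    (hstep : c < d → ∫ τ in c..d, h τ ≤ C * U d ^ η * U c ^ (-(ε + η)))
    (hUd : U d ≤ 2 * U c) : ∫ τ in c..d, h τ ≤ C * 2 ^ η * U c ^ (-ε) := by
  rcases hcd.eq_or_lt with rfl | hlt
  · rw [intervalIntegral.integral_same]
    positivity
  have hUd0 : 0 ≤ U d := hUpos.le.trans hUcd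
  calc ∫ τ in c..d, h τ ≤ C * U d ^ η * U c ^ (-(ε + η)) := hstep hlt
    _ ≤ C * (2 * U c) ^ η * U c ^ (-(ε + η)) := by gcongr
    _ = C * 2 ^ η * U c ^ (-ε) := by
        rw [Real.mul_rpow zero_le_two hUpos.le, mul_assoc, mul_assoc (2 ^ η),
          ← Real.rpow_add hUpos, ← mul_assoc]
        congr 2
        ring

/-- Summation over the doubling points of `U`. -/
theorem integral_le_of_doubling {U h : ℝ → ℝ} {C η ε : ℝ} (hη : 0 < η) (hε : 0 < ε) (hC : 0 ≤ C)
    (hUc : Continuous U) {d : ℝ} (j : ℕ) {c : ℝ} (hcd : c ≤ d) (hU : MonotoneOn U (Icc c d))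
    (hUpos : 0 < U c) (hint : IntervalIntegrable h volume c d)
    (hstep : ∀ s t, c ≤ s → s < t → t ≤ d →
      ∫ τ in s..t, h τ ≤ C * U t ^ η * U s ^ (-(ε + η)))
    (hj : U d ≤ 2 ^ j * U c) :
    ∫ τ in c..d, h τ ≤ C * 2 ^ η / (1 - 2 ^ (-ε)) * U c ^ (-ε) := by
  have h2ε : (2 : ℝ) ^ (-ε) < 1 := Real.rpow_lt_one_of_one_lt_of_neg one_lt_two (by linarith)
  have h2pos : 0 < 1 - (2 : ℝ) ^ (-ε) := by linarith
  have hCle : C * 2 ^ η ≤ C * 2 ^ η / (1 - 2 ^ (-ε)) := by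
    rw [le_div_iff₀ h2pos]
    have : 0 ≤ C * 2 ^ η * 2 ^ (-ε) := by positivity
    nlinarith
  induction j generalizing c with
  | zero =>
    refine (integral_le_of_le_two_mul hη hC hcd (hU (left_mem_Icc.2 hcd) (right_mem_Icc.2 hcd) hcd)
      hUpos (fun h => hstep c d le_rfl h le_rfl) (by linarith)).trans
      (mul_le_mul_of_nonneg_right hCle (Real.rpow_nonneg hUpos.le _))
  | succ j ih =>
    rcases le_or_gt (U d) (2 * U c) with hd | hd
    · exact (integral_le_of_le_two_mul hη hC hcd
        (hU (left_mem_Icc.2 hcd) (right_mem_Icc.2 hcd) hcd) hUpos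
        (fun h => hstep c d le_rfl h le_rfl) hd).trans
        (mul_le_mul_of_nonneg_right hCle (Real.rpow_nonneg hUpos.le _))
    -- At `e` the value of `U` is exactly twice that at `c`: `[c, e]` contributes one term, and the
    -- induction hypothesis bounds the rest with an extra factor `2^(-ε)`. The constant `1/(1 -
    -- 2^(-ε))` is the fixed point of this recursion, so it does not depend on `j`.
    obtain ⟨e, he, hUe⟩ := intermediate_value_Icc hcd hUc.continuousOn
      (show 2 * U c ∈ Icc (U c) (U d) from ⟨by linarith, hd.le⟩)
    have hUe0 : 0 < U e := by rw [hUe]; linarith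
    have hsub : Icc e d ⊆ Icc c d := Icc_subset_Icc_left he.1
    have hi1 : IntervalIntegrable h volume c e :=
      hint.mono_set (by rw [uIcc_of_le he.1, uIcc_of_le hcd]; exact Icc_subset_Icc_right he.2)
    have hi2 : IntervalIntegrable h volume e d :=
      hint.mono_set (by rw [uIcc_of_le he.2, uIcc_of_le hcd]; exact hsub)
    have h1 := integral_le_of_le_two_mul (ε := ε) hη hC he.1 (by linarith) hUpos
      (fun h => hstep c e le_rfl h he.2) hUe.le
    have h2 := ih he.2 (hU.mono hsub) hUe0 hi2
      (fun s t hs hst ht => hstep s t (he.1.trans hs) hst ht)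
      (by rw [hUe, ← mul_assoc, ← pow_succ]; exact hj)
    rw [← intervalIntegral.integral_add_adjacent_intervals hi1 hi2]
    refine (add_le_add h1 h2).trans (le_of_eq ?_)
    rw [hUe, Real.mul_rpow zero_le_two hUpos.le]
    field_simp
    ring

/-! ### The radial system and the bound for the density integral. -/

/-- The differential inequalities satisfied by the spherical means of a solution. -/
structure RadialSystem (N m n : ℕ) (ρ α β : ℝ) (f g U V : ℝ → ℝ) : Prop where
  hN : 3 ≤ N
  hm : 1 ≤ m
  hn : 1 ≤ n
  hρ : 0 < ρ
  hα : 1 ≤ α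
  hβ : 1 ≤ β
  hαβ : 1 < α * β
  f_nonneg : ∀ r, 0 ≤ f r
  g_nonneg : ∀ r, 0 ≤ g r
  f_int : ∀ a b, ρ ≤ a → a ≤ b → IntervalIntegrable f volume a b
  g_int : ∀ a b, ρ ≤ a → a ≤ b → IntervalIntegrable g volume a b
  f_anti : AntitoneOn (fun r : ℝ => r ^ (1 - (m : ℤ)) * f r) (Ioi ρ)
  g_anti : AntitoneOn (fun r : ℝ => r ^ (1 - (n : ℤ)) * g r) (Ioi ρ)
  U_cont : Continuous U
  V_cont : Continuous V
  U_nonneg : ∀ r, 0 ≤ U r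
  V_nonneg : ∀ r, 0 ≤ V r
  U_growth : RadialGrowth N f α V U
  V_growth : RadialGrowth N g β U V

theorem one_sub_div_pow_nonneg {s r : ℝ} (hs : 0 ≤ s) (hsr : s ≤ r) (k : ℕ) :
    0 ≤ 1 - (s / r) ^ k :=
  sub_nonneg.2 (pow_le_one₀ (div_nonneg hs (hs.trans hsr))
    (div_le_one_of_le₀ hsr (hs.trans hsr)))

/-- The constant `1 / (2 (N - 2))`. -/
def kernelConst (N : ℕ) : ℝ := 1 / (2 * ((N : ℝ) - 2))

theorem kernelConst_pos {N : ℕ} (hN : 3 ≤ N) : 0 < kernelConst N := by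
  have : (3 : ℝ) ≤ N := by exact_mod_cast hN
  unfold kernelConst
  apply div_pos one_pos
  linarith

/-- Since `(s/t)^k ≤ s/t`, it suffices to treat `k = 1`, where the kernel is `(t - s) s / t` and `s
/ t ≥ 1/2`. This is the origin of the restriction `b ≤ 2`. -/
theorem half_sub_le_kernel {k : ℕ} (hk : 1 ≤ k) {s t : ℝ} (hs : 0 < s) (hst : s ≤ t)
    (ht : t ≤ 2 * s) : (t - s) / 2 ≤ s * (1 - (s / t) ^ k) := by
  have ht0 : 0 < t := hs.trans_le hst
  have h1 : (s / t) ^ k ≤ s / t := by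
    simpa using pow_le_pow_of_le_one (div_nonneg hs.le ht0.le) (div_le_one_of_le₀ hst ht0.le) hk
  have h2 : (t - s) / 2 ≤ s * (1 - s / t) := by
    have : s * (1 - s / t) = (t - s) * (s / t) := by field_simp
    rw [this, div_eq_mul_one_div]
    refine mul_le_mul_of_nonneg_left ?_ (by linarith)
    rw [div_le_div_iff₀ two_pos ht0]
    linarith
  exact h2.trans (mul_le_mul_of_nonneg_left (by linarith) hs.le)

/-- Applied with `t - τ` in the role of `s`, it brings the nonincreasing quantity `τ^(1-m) f τ` into
the kernel. -/
theorem pow_mul_zpow_one_sub_le {m : ℕ} (hm : 1 ≤ m) {s τ : ℝ} (hτ : 0 < τ) (hs : 0 ≤ s)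
    (hsτ : s ≤ τ) : s ^ m * τ ^ (1 - (m : ℤ)) ≤ s := by
  have h1 : s ^ m = s ^ (m - 1) * s := by rw [← pow_succ, Nat.sub_add_cancel hm]
  have h2 : 0 ≤ τ ^ (1 - (m : ℤ)) := zpow_nonneg hτ.le _
  calc s ^ m * τ ^ (1 - (m : ℤ)) = s * (s ^ (m - 1) * τ ^ (1 - (m : ℤ))) := by rw [h1]; ring
    _ ≤ s * (τ ^ (m - 1) * τ ^ (1 - (m : ℤ))) := by gcongr
    _ = s := by rw [mul_comm (τ ^ (m - 1)), zpow_one_sub_mul_pow hm hτ.ne', mul_one]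

namespace RadialSystem

variable {N m n : ℕ} {ρ α β : ℝ} {f g U V : ℝ → ℝ}

theorem swap (S : RadialSystem N m n ρ α β f g U V) : RadialSystem N n m ρ β α g f V U :=
  { hN := S.hN, hm := S.hn, hn := S.hm, hρ := S.hρ, hα := S.hβ, hβ := S.hα
    hαβ := by rw [mul_comm]; exact S.hαβ
    f_nonneg := S.g_nonneg, g_nonneg := S.f_nonneg, f_int := S.g_int, g_int := S.f_int
    f_anti := S.g_anti, g_anti := S.f_anti, U_cont := S.V_cont, V_cont := S.U_cont
    U_nonneg := S.V_nonneg, V_nonneg := S.U_nonneg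
    U_growth := S.V_growth, V_growth := S.U_growth }

theorem dim_sub_two_pos (S : RadialSystem N m n ρ α β f g U V) : (0 : ℝ) < (N : ℝ) - 2 := by
  have : (3 : ℝ) ≤ N := by exact_mod_cast S.hN
  linarith

theorem kernel_nonneg (S : RadialSystem N m n ρ α β f g U V) {s r : ℝ} (hs : 0 ≤ s) (hsr : s ≤ r) :
    0 ≤ s * f s * (1 - (s / r) ^ (N - 2)) :=
  mul_nonneg (mul_nonneg hs (S.f_nonneg s)) (one_sub_div_pow_nonneg hs hsr _)

theorem monotoneOn_U (S : RadialSystem N m n ρ α β f g U V) : MonotoneOn U (Ioi 0) := by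
  intro r₀ hr₀ r _ hr
  have h := S.U_growth r₀ r hr₀ hr
  have h1 : 0 ≤ ∫ s in r₀..r, s * f s * (1 - (s / r) ^ (N - 2)) * V s ^ α :=
    intervalIntegral.integral_nonneg hr fun s hs =>
      mul_nonneg (S.kernel_nonneg ((le_of_lt hr₀).trans hs.1) hs.2)
        (Real.rpow_nonneg (S.V_nonneg s) _)
  have h2 : 0 ≤ 1 / ((N : ℝ) - 2) := (one_div_pos.2 S.dim_sub_two_pos).le
  nlinarith [mul_nonneg h2 h1]

theorem continuous_V_rpow (S : RadialSystem N m n ρ α β f g U V) : Continuous fun s => V s ^ α :=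
  S.V_cont.rpow_const fun _ => Or.inr (by linarith [S.hα])

theorem intervalIntegrable_kernel (S : RadialSystem N m n ρ α β f g U V) {a b : ℝ} (r : ℝ)
    (ha : ρ ≤ a) (hab : a ≤ b) {w : ℝ → ℝ} (hw : Continuous w) :
    IntervalIntegrable (fun s => s * f s * (1 - (s / r) ^ (N - 2)) * w s) volume a b := by
  have h : Continuous fun s => s * (1 - (s / r) ^ (N - 2)) * w s := by fun_prop
  refine ((S.f_int a b ha hab).continuousOn_mul h.continuousOn).congr fun s _ => ?_
  ring

theorem intervalIntegrable_shell (S : RadialSystem N m n ρ α β f g U V) {s t : ℝ}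
    (hs : ρ ≤ s) (hst : s ≤ t) {w : ℝ → ℝ} (hw : Continuous w) :
    IntervalIntegrable (fun τ => (t - τ) ^ m * τ ^ (1 - (m : ℤ)) * f τ * w τ) volume s t := by
  have h : ContinuousOn (fun τ : ℝ => (t - τ) ^ m * τ ^ (1 - (m : ℤ)) * w τ) (uIcc s t) := by
    rw [uIcc_of_le hst]
    refine ContinuousOn.mul (ContinuousOn.mul (by fun_prop) ?_) hw.continuousOn
    exact fun τ hτ => (continuousAt_zpow₀ τ _
      (Or.inl ((S.hρ.trans_le hs).trans_le hτ.1).ne')).continuousWithinAt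
  refine ((S.f_int s t hs hst).continuousOn_mul h).congr fun τ _ => ?_
  ring

/-- Serves twice: it bounds `y_k(R)` by a multiple of `U (a * R)`, and it feeds the lower bound for
`V` back into `U`. -/
theorem shell_le (S : RadialSystem N m n ρ α β f g U V) {s t : ℝ} (hs : ρ ≤ s) (hst : s ≤ t)
    (ht : t ≤ 2 * s) :
    kernelConst N * ∫ τ in s..t, (t - τ) ^ m * τ ^ (1 - (m : ℤ)) * f τ * V τ ^ α ≤ U t := by
  have hs0 : 0 < s := S.hρ.trans_le hs
  have h := S.U_growth s t hs0 hst
  have hU := S.U_nonneg s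
  have hN2 := S.dim_sub_two_pos
  refine le_trans ?_ ((le_add_of_nonneg_left hU).trans h)
  have hint := (S.intervalIntegrable_kernel t hs hst S.continuous_V_rpow).const_mul 2
  have hle : ∫ τ in s..t, (t - τ) ^ m * τ ^ (1 - (m : ℤ)) * f τ * V τ ^ α ≤
      ∫ τ in s..t, 2 * (τ * f τ * (1 - (τ / t) ^ (N - 2)) * V τ ^ α) := by
    refine intervalIntegral.integral_mono_on hst
      (S.intervalIntegrable_shell hs hst S.continuous_V_rpow) hint fun τ hτ => ?_
    have hτ0 : 0 < τ := hs0.trans_le hτ.1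
    have h1 := pow_mul_zpow_one_sub_le S.hm hτ0 (sub_nonneg.2 hτ.2)
      (show t - τ ≤ τ by linarith [hτ.1])
    have hN' := S.hN
    have h2 := half_sub_le_kernel (k := N - 2) (by omega) hτ0 hτ.2 (by linarith [hτ.1])
    have h3 : 0 ≤ f τ * V τ ^ α := mul_nonneg (S.f_nonneg τ) (Real.rpow_nonneg (S.V_nonneg τ) _)
    calc (t - τ) ^ m * τ ^ (1 - (m : ℤ)) * f τ * V τ ^ α
        = (t - τ) ^ m * τ ^ (1 - (m : ℤ)) * (f τ * V τ ^ α) := by ring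
      _ ≤ (2 * (τ * (1 - (τ / t) ^ (N - 2)))) * (f τ * V τ ^ α) :=
        mul_le_mul_of_nonneg_right (by linarith) h3
      _ = _ := by ring
  rw [intervalIntegral.integral_const_mul] at hle
  have hc := kernelConst_pos S.hN
  refine (mul_le_mul_of_nonneg_left hle hc.le).trans (le_of_eq ?_)
  rw [kernelConst, ← mul_assoc]
  congr 1
  field_simp

/-- Growth of `V` over an interval on which `U` is bounded below. -/
theorem mul_rpow_le_V (S : RadialSystem N m n ρ α β f g U V) {s t : ℝ} (hs : ρ < s) (hst : s ≤ t)
    (ht : t ≤ 2 * s) :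
    kernelConst N / (n + 1) * (t ^ (1 - (n : ℤ)) * g t) * U s ^ β * (t - s) ^ (n + 1) ≤ V t := by
  have hs0 : 0 < s := S.hρ.trans hs
  refine le_trans ?_ (S.swap.shell_le hs.le hst ht)
  have hc := kernelConst_pos S.hN
  -- The nonincreasing shifted weight is frozen at the right endpoint and the nondecreasing `U` at
  -- the left one; what remains integrates to `(t-s)^(n+1)/(n+1)`.
  have hle : ∫ τ in s..t, (t - τ) ^ n * ((t ^ (1 - (n : ℤ)) * g t) * U s ^ β) ≤
      ∫ τ in s..t, (t - τ) ^ n * τ ^ (1 - (n : ℤ)) * g τ * U τ ^ β := by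
    refine intervalIntegral.integral_mono_on hst (Continuous.intervalIntegrable (by fun_prop) _ _)
      (S.swap.intervalIntegrable_shell hs.le hst S.swap.continuous_V_rpow) fun τ hτ => ?_
    have hτ0 : 0 < τ := hs0.trans_le hτ.1
    have h1 : t ^ (1 - (n : ℤ)) * g t ≤ τ ^ (1 - (n : ℤ)) * g τ :=
      S.g_anti (hs.trans_le hτ.1) (hs.trans_le hst) hτ.2
    have h2 : U s ^ β ≤ U τ ^ β :=
      Real.rpow_le_rpow (S.U_nonneg s) (S.monotoneOn_U hs0 hτ0 hτ.1) (by linarith [S.hβ])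
    have h3 : 0 ≤ τ ^ (1 - (n : ℤ)) * g τ := mul_nonneg (zpow_nonneg hτ0.le _) (S.g_nonneg τ)
    have h4 : 0 ≤ U s ^ β := Real.rpow_nonneg (S.U_nonneg s) _
    have h5 : 0 ≤ (t - τ) ^ n := pow_nonneg (sub_nonneg.2 hτ.2) _
    calc _ ≤ (t - τ) ^ n * ((τ ^ (1 - (n : ℤ)) * g τ) * U τ ^ β) := by gcongr
      _ = _ := by ring
  refine le_trans (le_of_eq ?_) (mul_le_mul_of_nonneg_left hle hc.le)
  rw [intervalIntegral.integral_mul_const,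
    intervalIntegral.integral_comp_sub_left (fun x : ℝ => x ^ n), integral_pow, sub_self,
    zero_pow (Nat.succ_ne_zero n)]
  field_simp
  ring

/-- The integrand of the growth condition. -/
def density (m n : ℕ) (α : ℝ) (f g : ℝ → ℝ) (s : ℝ) : ℝ :=
  (s ^ (1 - (m : ℤ)) * f s * (s ^ (1 - (n : ℤ)) * g s) ^ α) ^ (1 / ((n + 1) * α + m + 1))

theorem f_shift_nonneg (S : RadialSystem N m n ρ α β f g U V) {r : ℝ} (hr : r ∈ Ioi ρ) :
    0 ≤ r ^ (1 - (m : ℤ)) * f r :=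
  mul_nonneg (zpow_nonneg (S.hρ.trans hr).le _) (S.f_nonneg r)

theorem antitoneOn_product (S : RadialSystem N m n ρ α β f g U V) :
    AntitoneOn (fun s : ℝ => s ^ (1 - (m : ℤ)) * f s * (s ^ (1 - (n : ℤ)) * g s) ^ α) (Ioi ρ) := by
  intro s hs t ht hst
  exact mul_le_mul (S.f_anti hs ht hst)
    (Real.rpow_le_rpow (S.swap.f_shift_nonneg ht) (S.g_anti hs ht hst) (by linarith [S.hα]))
    (Real.rpow_nonneg (S.swap.f_shift_nonneg ht) _) (S.f_shift_nonneg hs)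

theorem product_nonneg (S : RadialSystem N m n ρ α β f g U V) {s : ℝ} (hs : s ∈ Ioi ρ) :
    0 ≤ s ^ (1 - (m : ℤ)) * f s * (s ^ (1 - (n : ℤ)) * g s) ^ α :=
  mul_nonneg (S.f_shift_nonneg hs) (Real.rpow_nonneg (S.swap.f_shift_nonneg hs) _)

theorem exponent_pos (S : RadialSystem N m n ρ α β f g U V) :
    0 < ((n : ℝ) + 1) * α + m + 1 := by
  have := S.hα
  positivity

theorem antitoneOn_density (S : RadialSystem N m n ρ α β f g U V) :
    AntitoneOn (density m n α f g) (Ioi ρ) := fun _ hs _ ht hst =>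
  Real.rpow_le_rpow (S.product_nonneg ht) (S.antitoneOn_product hs ht hst)
    (one_div_pos.2 S.exponent_pos).le

theorem density_nonneg (S : RadialSystem N m n ρ α β f g U V) {s : ℝ} (hs : s ∈ Ioi ρ) :
    0 ≤ density m n α f g s :=
  Real.rpow_nonneg (S.product_nonneg hs) _

theorem Icc_subset_Ioi {s t : ℝ} (hs : ρ < s) : Icc s t ⊆ Ioi ρ := fun _ hx => hs.trans_le hx.1

theorem intervalIntegrable_density (S : RadialSystem N m n ρ α β f g U V) {s t : ℝ} (hs : ρ < s)
    (hst : s ≤ t) : IntervalIntegrable (density m n α f g) volume s t :=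
  (S.antitoneOn_density.mono
    (by rw [uIcc_of_le hst]; exact Icc_subset_Ioi hs)).intervalIntegrable

/-- The constant in `integral_density_le`. -/
def densityConst (N m n : ℕ) (α : ℝ) : ℝ :=
  betaConst m ((n + 1) * α) *
    (kernelConst N * (kernelConst N / (n + 1)) ^ α)⁻¹ ^ (1 / ((n + 1) * α + m + 1))

/-- Inserting the lower bound `mul_rpow_le_V` on `[s, τ]` into `shell_le` gives `U t ≥ C U(s)^(αβ) ∫
(t-τ)^m (τ-s)^((n+1)α) density^σ`. The Beta-weight Hölder inequality with `μ = m`, `κ = (n+1)α`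
applies because `σ = μ + κ + 1`; this explains the exponent in `density`. -/
theorem integral_density_le (S : RadialSystem N m n ρ α β f g U V) {s t : ℝ} (hs : ρ < s)
    (hst : s < t) (ht : t ≤ 2 * s) (hUs : 0 < U s) :
    ∫ τ in s..t, density m n α f g τ ≤ densityConst N m n α *
      U t ^ (1 / ((n + 1) * α + m + 1)) * U s ^ (-(α * β / ((n + 1) * α + m + 1))) := by
  have hα0 : 0 < α := by linarith [S.hα]
  have hκ : 0 < ((n : ℝ) + 1) * α := by positivity
  have hμ : 0 < (m : ℝ) := by exact_mod_cast S.hm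
  have hσ : ((n : ℝ) + 1) * α + m + 1 = m + (n + 1) * α + 1 := by ring
  have hσ0 := S.exponent_pos
  set σ := ((n : ℝ) + 1) * α + m + 1 with hσdef
  have hc := kernelConst_pos S.hN
  set c := kernelConst N with hcdef
  set d := c / ((n : ℝ) + 1) with hd
  have hd0 : 0 < d := by positivity
  set H : ℝ → ℝ := fun τ => τ ^ (1 - (m : ℤ)) * f τ * (τ ^ (1 - (n : ℤ)) * g τ) ^ α with hH
  have hs0 : 0 < s := S.hρ.trans hs
  have hIoo : ∀ τ ∈ Ioo s t, τ ∈ Ioi ρ := fun τ hτ => hs.trans hτ.1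
  have hpow : ∀ τ ∈ Ioo s t, (t - τ) ^ (m : ℝ) * (τ - s) ^ (((n : ℝ) + 1) * α) *
      density m n α f g τ ^ ((m : ℝ) + (n + 1) * α + 1) =
      (t - τ) ^ m * (τ - s) ^ (((n : ℝ) + 1) * α) * H τ := by
    intro τ hτ
    rw [← hσ, density, ← Real.rpow_mul (S.product_nonneg (hIoo τ hτ)), one_div_mul_cancel hσ0.ne',
      Real.rpow_one, Real.rpow_natCast]
  have hwc : Continuous fun τ : ℝ => (t - τ) ^ m * (τ - s) ^ (((n : ℝ) + 1) * α) :=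
    Continuous.mul (by fun_prop)
      ((continuous_id.sub continuous_const).rpow_const fun _ => Or.inr hκ.le)
  have hHi : IntervalIntegrable H volume s t :=
    (S.antitoneOn_product.mono
      (by rw [uIcc_of_le hst.le]; exact Icc_subset_Ioi hs)).intervalIntegrable
  have hXi : IntervalIntegrable
      (fun τ => (t - τ) ^ m * (τ - s) ^ (((n : ℝ) + 1) * α) * H τ) volume s t :=
    hHi.continuousOn_mul hwc.continuousOn
  have hXi' := ((intervalIntegrable_iff_integrableOn_Ioc_of_le hst.le).1 hXi).mono_set
    Ioo_subset_Ioc_self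
  have hhi := ((intervalIntegrable_iff_integrableOn_Ioc_of_le hst.le).1
    (S.intervalIntegrable_density hs hst.le)).mono_set Ioo_subset_Ioc_self
  have hHol := integral_le_betaWeight hμ hκ hst
    (fun τ hτ => S.density_nonneg (hIoo τ hτ)) hhi.aestronglyMeasurable
    (hXi'.congr_fun (fun τ hτ => (hpow τ hτ).symm) measurableSet_Ioo)
  rw [setIntegral_congr_fun measurableSet_Ioo hpow, ← integral_Ioc_eq_integral_Ioo,
    ← integral_Ioc_eq_integral_Ioo, ← intervalIntegral.integral_of_le hst.le,
    ← intervalIntegral.integral_of_le hst.le, ← hσ] at hHol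
  set X := ∫ τ in s..t, (t - τ) ^ m * (τ - s) ^ (((n : ℝ) + 1) * α) * H τ with hX
  have hX0 : 0 ≤ X := by
    refine intervalIntegral.integral_nonneg hst.le fun τ hτ => mul_nonneg (mul_nonneg
      (pow_nonneg (sub_nonneg.2 hτ.2) _) (Real.rpow_nonneg (sub_nonneg.2 hτ.1) _))
      (S.product_nonneg (Icc_subset_Ioi hs hτ))
  have hlow : (d * U s ^ β) ^ α * X ≤
      ∫ τ in s..t, (t - τ) ^ m * τ ^ (1 - (m : ℤ)) * f τ * V τ ^ α := by
    rw [hX, ← intervalIntegral.integral_const_mul]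
    refine intervalIntegral.integral_mono_on hst.le (hXi.const_mul _)
      (S.intervalIntegrable_shell hs.le hst.le S.continuous_V_rpow) fun τ hτ => ?_
    have hτρ : τ ∈ Ioi ρ := Icc_subset_Ioi hs hτ
    have h1 := S.mul_rpow_le_V hs hτ.1 (hτ.2.trans ht)
    have hg := S.swap.f_shift_nonneg hτρ
    have hsub : 0 ≤ τ - s := sub_nonneg.2 hτ.1
    have hUβ : 0 < U s ^ β := Real.rpow_pos_of_pos hUs _
    have h2 : (d * U s ^ β) ^ α * ((τ ^ (1 - (n : ℤ)) * g τ) ^ α *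
        (τ - s) ^ (((n : ℝ) + 1) * α)) ≤ V τ ^ α := by
      refine le_trans (le_of_eq ?_) (Real.rpow_le_rpow (by positivity) h1 hα0.le)
      have e1 : (τ - s) ^ (((n : ℝ) + 1) * α) = ((τ - s) ^ (n + 1)) ^ α := by
        rw [Real.rpow_mul hsub]
        congr 1
        exact_mod_cast Real.rpow_natCast (τ - s) (n + 1)
      rw [e1, ← Real.mul_rpow hg (by positivity), ← Real.mul_rpow (by positivity) (by positivity)]
      congr 1
      ring
    have h3 : 0 ≤ (t - τ) ^ m * (τ ^ (1 - (m : ℤ)) * f τ) :=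
      mul_nonneg (pow_nonneg (sub_nonneg.2 hτ.2) _) (S.f_shift_nonneg hτρ)
    calc _ = (t - τ) ^ m * (τ ^ (1 - (m : ℤ)) * f τ) * ((d * U s ^ β) ^ α *
          ((τ ^ (1 - (n : ℤ)) * g τ) ^ α * (τ - s) ^ (((n : ℝ) + 1) * α))) := by
          simp only [hH]; ring
      _ ≤ (t - τ) ^ m * (τ ^ (1 - (m : ℤ)) * f τ) * V τ ^ α := mul_le_mul_of_nonneg_left h2 h3
      _ = _ := by ring
  have hfin : c * ((d * U s ^ β) ^ α * X) ≤ U t :=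
    (mul_le_mul_of_nonneg_left hlow hc.le).trans (S.shell_le hs.le hst.le ht)
  -- The preceding inequality solved for `X`, which is possible since `U s > 0`.
  have hXle : X ≤ (c * d ^ α)⁻¹ * U t * U s ^ (-(α * β)) := by
    rw [Real.mul_rpow hd0.le (Real.rpow_nonneg hUs.le _), ← Real.rpow_mul hUs.le,
      mul_comm β α] at hfin
    rw [Real.rpow_neg hUs.le, ← div_eq_mul_inv, le_div_iff₀ (Real.rpow_pos_of_pos hUs _),
      ← div_eq_inv_mul, le_div_iff₀ (by positivity)]
    linarith
  have hβ0 := betaConst_nonneg hμ hκ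
  have hUt : 0 ≤ U t := S.U_nonneg t
  have hcd : 0 ≤ (c * d ^ α)⁻¹ := by positivity
  refine hHol.trans ((mul_le_mul_of_nonneg_left (Real.rpow_le_rpow hX0 hXle
    (one_div_pos.2 hσ0).le) hβ0).trans (le_of_eq ?_))
  rw [Real.mul_rpow (mul_nonneg hcd hUt) (Real.rpow_nonneg hUs.le _), Real.mul_rpow hcd hUt,
    ← Real.rpow_mul hUs.le, densityConst]
  have : -(α * β) * (1 / σ) = -(α * β / σ) := by ring
  rw [this]
  ring

/-- The constant in `integral_density_le_rpow`. -/
def blowupConst (N m n : ℕ) (α β : ℝ) : ℝ :=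
  densityConst N m n α * 2 ^ (1 / ((n + 1) * α + m + 1)) /
    (1 - 2 ^ (-((α * β - 1) / ((n + 1) * α + m + 1))))

theorem densityConst_nonneg (S : RadialSystem N m n ρ α β f g U V) : 0 ≤ densityConst N m n α := by
  have hα0 : 0 < α := by linarith [S.hα]
  have hμ : 0 < (m : ℝ) := by exact_mod_cast S.hm
  have hb : 0 ≤ betaConst (m : ℝ) ((n + 1) * α) := betaConst_nonneg hμ (by positivity)
  have hc := kernelConst_pos S.hN
  unfold densityConst
  positivity

theorem growth_exponent_pos (S : RadialSystem N m n ρ α β f g U V) :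
    0 < (α * β - 1) / ((n + 1) * α + m + 1) :=
  div_pos (by linarith [S.hαβ]) S.exponent_pos

/-- The doubling argument with `η = 1/σ` and `ε = (αβ-1)/σ` removes the dependence on the right
endpoint. The number `j` of doublings is arbitrary and does not enter the constant. -/
theorem integral_density_le_rpow (S : RadialSystem N m n ρ α β f g U V) {c d : ℝ} (hc : ρ < c)
    (hcd : c ≤ d) (hd : d ≤ 2 * c) (hU : 0 < U c) :
    ∫ τ in c..d, density m n α f g τ ≤
      blowupConst N m n α β * U c ^ (-((α * β - 1) / ((n + 1) * α + m + 1))) := by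
  have hc0 : 0 < c := S.hρ.trans hc
  have hmono : MonotoneOn U (Icc c d) := S.monotoneOn_U.mono (Icc_subset_Ioi hc0)
  obtain ⟨j, hj⟩ := pow_unbounded_of_one_lt (U d / U c) one_lt_two
  refine integral_le_of_doubling (one_div_pos.2 S.exponent_pos) S.growth_exponent_pos
    S.densityConst_nonneg S.U_cont j hcd hmono hU (S.intervalIntegrable_density hc hcd) ?_
    ((div_lt_iff₀ hU).1 hj).le
  intro s t hs hst ht
  have hUs : 0 < U s := hU.trans_le (hmono (left_mem_Icc.2 hcd) ⟨hs, hst.le.trans ht⟩ hs)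
  have h := S.integral_density_le (hc.trans_le hs) hst (by linarith) hUs
  have e : (α * β - 1) / ((n + 1) * α + m + 1) + 1 / ((n + 1) * α + m + 1) =
      α * β / ((n + 1) * α + m + 1) := by
    rw [← add_div, sub_add_cancel]
  rwa [e]

end RadialSystem

/-! ### Domination of the iterates and boundedness of the growth expression. -/

theorem iterate_swap (N : ℕ) (ρ α β : ℝ) (P Q : ℝ → ℝ) (k : ℕ) :
    iterate N ρ β α Q P k = (iterate N ρ α β P Q k).swap := by
  induction k with
  | zero => rfl
  | succ k ih => simp [iterate, ih]

namespace RadialSystem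

variable {N m n : ℕ} {ρ α β : ℝ} {f g U V : ℝ → ℝ}

/-- The truncation `max s r₀` is needed because `V` may vanish between `ρ` and `r₀`, where no
multiple of it could dominate the iterates. Beyond `r₀` the growth inequality bounds the integral by
`U r`; the part up to `r₀` is bounded and is absorbed using `U r₀ > 0`. -/
theorem exists_integral_kernel_le (S : RadialSystem N m n ρ α β f g U V) {r₀ : ℝ} (hr₀ : ρ ≤ r₀)
    (hU : 0 < U r₀) : ∃ C, 0 ≤ C ∧ ∀ r, ρ ≤ r →
      1 / ((N : ℝ) - 2) * ∫ s in ρ..r, s * f s * (1 - (s / r) ^ (N - 2)) * V (max s r₀) ^ α ≤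
        C * U (max r r₀) := by
  have hr₀0 : 0 < r₀ := S.hρ.trans_le hr₀
  have hN2 : 0 < 1 / ((N : ℝ) - 2) := one_div_pos.2 S.dim_sub_two_pos
  have hW : Continuous fun s => V (max s r₀) ^ α :=
    (S.V_cont.comp (continuous_id.max continuous_const)).rpow_const
      fun _ => Or.inr (by linarith [S.hα])
  have hW0 : ∀ s, 0 ≤ V (max s r₀) ^ α := fun s => Real.rpow_nonneg (S.V_nonneg _) _
  have hBi : ∀ b, ρ ≤ b → IntervalIntegrable (fun s => s * f s * V (max s r₀) ^ α) volume ρ b := by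
    intro b hb
    refine ((S.f_int ρ b le_rfl hb).continuousOn_mul
      (continuous_id.mul hW).continuousOn).congr fun s _ => ?_
    simp only [Pi.mul_apply, id]
    ring
  have hBnn : ∀ s, ρ ≤ s → 0 ≤ s * f s * V (max s r₀) ^ α := fun s hs =>
    mul_nonneg (mul_nonneg (S.hρ.le.trans hs) (S.f_nonneg s)) (hW0 s)
  set B := ∫ s in ρ..r₀, s * f s * V (max s r₀) ^ α with hB
  have hB0 : 0 ≤ B := intervalIntegral.integral_nonneg hr₀ fun s hs => hBnn s hs.1
  have hbound : ∀ b r, ρ ≤ b → b ≤ r₀ → b ≤ r →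
      ∫ s in ρ..b, s * f s * (1 - (s / r) ^ (N - 2)) * V (max s r₀) ^ α ≤ B := by
    intro b r hb hbr₀ hbr
    calc _ ≤ ∫ s in ρ..b, s * f s * V (max s r₀) ^ α := by
          refine intervalIntegral.integral_mono_on hb
            (S.intervalIntegrable_kernel r le_rfl hb hW) (hBi b hb) fun s hs => ?_
          have hs0 : 0 ≤ s := S.hρ.le.trans hs.1
          have h1 : 1 - (s / r) ^ (N - 2) ≤ 1 :=
            sub_le_self _ (pow_nonneg (div_nonneg hs0 (hs0.trans (hs.2.trans hbr))) _)
          refine mul_le_mul_of_nonneg_right ?_ (hW0 s)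
          exact mul_le_of_le_one_right (mul_nonneg hs0 (S.f_nonneg s)) h1
      _ ≤ B := by
          have h := intervalIntegral.integral_add_adjacent_intervals (hBi b hb)
            ((hBi b hb).symm.trans (hBi r₀ hr₀))
          have h2 : 0 ≤ ∫ s in b..r₀, s * f s * V (max s r₀) ^ α :=
            intervalIntegral.integral_nonneg hbr₀ fun s hs => hBnn s (hb.trans hs.1)
          linarith
  -- The first summand pays for the integral up to `r₀`, the `1` for the integral beyond it.
  refine ⟨1 / ((N : ℝ) - 2) * B / U r₀ + 1, by positivity, fun r hr => ?_⟩
  have hmax : U r₀ ≤ U (max r r₀) :=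
    S.monotoneOn_U hr₀0 (hr₀0.trans_le (le_max_right _ _)) (le_max_right _ _)
  have h1 : 1 / ((N : ℝ) - 2) * B ≤ 1 / ((N : ℝ) - 2) * B / U r₀ * U (max r r₀) := by
    rw [div_mul_eq_mul_div (_ * B), le_div_iff₀ hU]
    exact mul_le_mul_of_nonneg_left hmax (by positivity)
  have h2 := S.U_nonneg (max r r₀)
  rw [add_mul, one_mul]
  rcases le_total r r₀ with h | h
  · have := mul_le_mul_of_nonneg_left (hbound r r hr h le_rfl) hN2.le
    linarith
  · rw [← intervalIntegral.integral_add_adjacent_intervals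
      (S.intervalIntegrable_kernel r le_rfl hr₀ hW) (S.intervalIntegrable_kernel r hr₀ h hW),
      mul_add]
    have h3 := mul_le_mul_of_nonneg_left (hbound r₀ r hr₀ le_rfl h) hN2.le
    have h4 := S.U_growth r₀ r hr₀0 h
    have h5 : ∫ s in r₀..r, s * f s * (1 - (s / r) ^ (N - 2)) * V (max s r₀) ^ α =
        ∫ s in r₀..r, s * f s * (1 - (s / r) ^ (N - 2)) * V s ^ α := by
      refine intervalIntegral.integral_congr fun s hs => ?_
      rw [uIcc_of_le h] at hs
      simp only [max_eq_left hs.1]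
    rw [h5]
    rw [max_eq_left h] at h1 ⊢
    linarith

theorem exists_radialStep_le (S : RadialSystem N m n ρ α β f g U V) {r₀ : ℝ} (hr₀ : ρ ≤ r₀)
    (hU : 0 < U r₀) {w : ℝ → ℝ} {C : ℝ} (hC : 0 ≤ C)
    (hw : ∀ r, ρ ≤ r → 0 ≤ w r ∧ w r ≤ C * V (max r r₀)) :
    ∃ C', 0 ≤ C' ∧ ∀ r, ρ ≤ r →
      0 ≤ radialStep N ρ f α w r ∧ radialStep N ρ f α w r ≤ C' * U (max r r₀) := by
  obtain ⟨D, hD0, hD⟩ := S.exists_integral_kernel_le hr₀ hU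
  have hα0 : 0 ≤ α := by linarith [S.hα]
  have hN2 : 0 < 1 / ((N : ℝ) - 2) := one_div_pos.2 S.dim_sub_two_pos
  have hCα : 0 ≤ C ^ α := Real.rpow_nonneg hC _
  refine ⟨C ^ α * D, mul_nonneg hCα hD0, fun r hr => ?_⟩
  have hnn : ∀ s ∈ Icc ρ r, 0 ≤ s * f s * (1 - (s / r) ^ (N - 2)) * w s ^ α := fun s hs =>
    mul_nonneg (S.kernel_nonneg (S.hρ.le.trans hs.1) hs.2) (Real.rpow_nonneg (hw s hs.1).1 _)
  refine ⟨mul_nonneg hN2.le (intervalIntegral.integral_nonneg hr hnn), ?_⟩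
  have hW : Continuous fun s => V (max s r₀) ^ α :=
    (S.V_cont.comp (continuous_id.max continuous_const)).rpow_const fun _ => Or.inr hα0
  have hle : ∫ s in ρ..r, s * f s * (1 - (s / r) ^ (N - 2)) * w s ^ α ≤
      ∫ s in ρ..r, C ^ α * (s * f s * (1 - (s / r) ^ (N - 2)) * V (max s r₀) ^ α) := by
    rw [intervalIntegral.integral_of_le hr, intervalIntegral.integral_of_le hr]
    -- Integrability of the majorant suffices, so measurability of the iterates never has to be
    -- tracked.
    refine integral_mono_of_nonneg ?_
      ((S.intervalIntegrable_kernel r le_rfl hr hW).const_mul _).1 ?_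
    · filter_upwards [ae_restrict_mem measurableSet_Ioc] with s hs
      exact hnn s ⟨hs.1.le, hs.2⟩
    · filter_upwards [ae_restrict_mem measurableSet_Ioc] with s hs
      obtain ⟨h0, h1⟩ := hw s hs.1.le
      have h2 := Real.rpow_le_rpow h0 h1 hα0
      rw [Real.mul_rpow hC (S.V_nonneg _)] at h2
      refine (mul_le_mul_of_nonneg_left h2
        (S.kernel_nonneg (S.hρ.le.trans hs.1.le) hs.2)).trans (le_of_eq ?_)
      ring
  rw [intervalIntegral.integral_const_mul] at hle
  calc radialStep N ρ f α w r ≤ 1 / ((N : ℝ) - 2) * (C ^ α *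
        ∫ s in ρ..r, s * f s * (1 - (s / r) ^ (N - 2)) * V (max s r₀) ^ α) :=
        mul_le_mul_of_nonneg_left hle hN2.le
    _ = C ^ α * (1 / ((N : ℝ) - 2) *
        ∫ s in ρ..r, s * f s * (1 - (s / r) ^ (N - 2)) * V (max s r₀) ^ α) := by ring
    _ ≤ C ^ α * (D * U (max r r₀)) := mul_le_mul_of_nonneg_left (hD r hr) hCα
    _ = _ := by ring

/-- The constant start `1` is dominated since `U` and `V` stay above their positive values at `r₀`;
each iteration step preserves domination because `U` and `V` grow at least as the same integral
operators prescribe. The constants depend on `k` but not on `r`. -/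
theorem exists_iterate_le (S : RadialSystem N m n ρ α β f g U V) {r₀ : ℝ} (hr₀ : ρ ≤ r₀)
    (hU : 0 < U r₀) (hV : 0 < V r₀) (k : ℕ) :
    (∃ C, 0 ≤ C ∧ ∀ r, ρ ≤ r → 0 ≤ (iterate N ρ α β f g k).1 r ∧
      (iterate N ρ α β f g k).1 r ≤ C * U (max r r₀)) ∧
    (∃ C, 0 ≤ C ∧ ∀ r, ρ ≤ r → 0 ≤ (iterate N ρ α β f g k).2 r ∧
      (iterate N ρ α β f g k).2 r ≤ C * V (max r r₀)) := by
  have hr₀0 : 0 < r₀ := S.hρ.trans_le hr₀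
  induction k with
  | zero =>
    refine ⟨⟨1 / U r₀, by positivity, fun r _ => ⟨zero_le_one, ?_⟩⟩,
      ⟨1 / V r₀, by positivity, fun r _ => ⟨zero_le_one, ?_⟩⟩⟩
    · rw [div_mul_eq_mul_div, one_mul]
      exact (one_le_div hU).2 (S.monotoneOn_U hr₀0 (hr₀0.trans_le (le_max_right _ _))
        (le_max_right _ _))
    · rw [div_mul_eq_mul_div, one_mul]
      exact (one_le_div hV).2 (S.swap.monotoneOn_U hr₀0 (hr₀0.trans_le (le_max_right _ _))
        (le_max_right _ _))
  | succ k ih =>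
    obtain ⟨⟨C₁, hC₁, h₁⟩, ⟨C₂, hC₂, h₂⟩⟩ := ih
    exact ⟨S.exists_radialStep_le hr₀ hU hC₂ h₂, S.swap.exists_radialStep_le hr₀ hV hC₁ h₁⟩

theorem density_eq_zero_of_g_eq_zero (S : RadialSystem N m n ρ α β f g U V) {s : ℝ}
    (hg : s ^ (1 - (n : ℤ)) * g s = 0) : density m n α f g s = 0 := by
  rw [density, hg, Real.zero_rpow (by linarith [S.hα]), mul_zero,
    Real.zero_rpow (one_div_pos.2 S.exponent_pos).ne']

theorem density_eq_zero_of_f_eq_zero (S : RadialSystem N m n ρ α β f g U V) {s : ℝ}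
    (hf : s ^ (1 - (m : ℤ)) * f s = 0) : density m n α f g s = 0 := by
  rw [density, hf, zero_mul, Real.zero_rpow (one_div_pos.2 S.exponent_pos).ne']

/-- Handles semitrivial pairs: a nonzero weight at `t` would force `V t > 0` through
`mul_rpow_le_V`. -/
theorem g_eq_zero_of_V_eq_zero (S : RadialSystem N m n ρ α β f g U V)
    (hV : ∀ r, 0 < r → V r = 0) {r₀ : ℝ} (hr₀ : ρ < r₀) (hU : 0 < U r₀) {t : ℝ} (ht : r₀ < t) :
    t ^ (1 - (n : ℤ)) * g t = 0 := by
  have hr₀0 : 0 < r₀ := S.hρ.trans hr₀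
  -- Lies beyond `r₀`, strictly below `t`, and satisfies `t ≤ 2s`.
  set s := max r₀ (t / 2) with hs
  have hst : s < t := max_lt ht (by linarith [hr₀0.trans ht])
  have hUs : 0 < U s :=
    hU.trans_le (S.monotoneOn_U hr₀0 (hr₀0.trans_le (le_max_left _ _)) (le_max_left _ _))
  have h := S.mul_rpow_le_V (hr₀.trans_le (le_max_left _ _)) hst.le
    (by linarith [le_max_right r₀ (t / 2)])
  rw [hV t (hr₀0.trans ht)] at h
  have hg := S.swap.f_shift_nonneg (hr₀.trans ht)
  refine le_antisymm (not_lt.1 fun hlt => ?_) hg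
  have hc := kernelConst_pos S.hN
  have h1 : 0 < U s ^ β := Real.rpow_pos_of_pos hUs _
  have h2 : 0 < (t - s) ^ (n + 1) := pow_pos (sub_pos.2 hst) _
  have : 0 < kernelConst N / (n + 1) * (t ^ (1 - (n : ℤ)) * g t) * U s ^ β * (t - s) ^ (n + 1) := by
    positivity
  linarith

/-- The expression in the growth condition. -/
def growthFun (N m n : ℕ) (ρ α β a b : ℝ) (f g : ℝ → ℝ) (k : ℕ) (R : ℝ) : ℝ :=
  yFun N m ρ a α β f g k R ^ ((α * β - 1) / ((n + 1) * α + m + 1)) *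
    ∫ s in (a * R)..(b * R), density m n α f g s

theorem eventually_growthFun_eq_zero {a b : ℝ} (ha : 1 < a) (hab : a < b) (k : ℕ) {r₀ : ℝ}
    (h : ∀ s, r₀ < s → density m n α f g s = 0) :
    ∀ᶠ R in atTop, growthFun N m n ρ α β a b f g k R = 0 := by
  filter_upwards [eventually_gt_atTop r₀, eventually_gt_atTop 0] with R hR hR0
  have hle : a * R ≤ b * R := by nlinarith
  have h0 : ∫ s in (a * R)..(b * R), density m n α f g s = 0 := by
    refine intervalIntegral.integral_zero_ae (Eventually.of_forall fun s hs => h s ?_)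
    rw [uIoc_of_le hle] at hs
    nlinarith [hs.1]
  rw [growthFun, h0, mul_zero]

/-- With `ε = (αβ-1)/σ`, the factor `y_k^ε` is at most a multiple of `U(aR)^ε`, and the density
integral is at most a multiple of `U(aR)^(-ε)`. -/
theorem exists_eventually_growthFun_le_of_pos (S : RadialSystem N m n ρ α β f g U V) {a b : ℝ}
    (ha : 1 < a) (hab : a < b) (hb : b ≤ 2) (k : ℕ) {r₀ : ℝ} (hr₀ : ρ ≤ r₀) (hU : 0 < U r₀)
    (hV : 0 < V r₀) : ∃ C, ∀ᶠ R in atTop, growthFun N m n ρ α β a b f g k R ≤ C := by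
  obtain ⟨-, C, hC, hit⟩ := S.exists_iterate_le hr₀ hU hV k
  have hα0 : 0 ≤ α := by linarith [S.hα]
  have hc := kernelConst_pos S.hN
  set c := kernelConst N
  set ε := (α * β - 1) / (((n : ℝ) + 1) * α + m + 1) with hε
  have hε0 : 0 < ε := S.growth_exponent_pos
  set D := C ^ α / c with hD
  have hD0 : 0 ≤ D := by positivity
  refine ⟨D ^ ε * blowupConst N m n α β, ?_⟩
  filter_upwards [eventually_gt_atTop r₀] with R hR
  have hRρ : ρ < R := hr₀.trans_lt hR
  have hR0 : 0 < R := S.hρ.trans hRρ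
  have hRaR : R ≤ a * R := by nlinarith
  have hy : shellIntegral m a f α (iterate N ρ α β f g k).2 R ≤ D * U (a * R) := by
    have h1 : shellIntegral m a f α (iterate N ρ α β f g k).2 R ≤
        ∫ τ in R..a * R, C ^ α * ((a * R - τ) ^ m * τ ^ (1 - (m : ℤ)) * f τ * V τ ^ α) := by
      rw [shellIntegral, intervalIntegral.integral_of_le hRaR,
        intervalIntegral.integral_of_le hRaR]
      have hk : ∀ s ∈ Ioc R (a * R), 0 ≤ (a * R - s) ^ m * s ^ (1 - (m : ℤ)) * f s := fun s hs =>
        mul_nonneg (mul_nonneg (pow_nonneg (sub_nonneg.2 hs.2) _)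
          (zpow_nonneg (hR0.trans hs.1).le _)) (S.f_nonneg s)
      refine integral_mono_of_nonneg ?_ ((S.intervalIntegrable_shell hRρ.le hRaR
        S.continuous_V_rpow).const_mul _).1 ?_
      · filter_upwards [ae_restrict_mem measurableSet_Ioc] with s hs
        exact mul_nonneg (hk s hs) (Real.rpow_nonneg (hit s (hRρ.trans hs.1).le).1 _)
      · filter_upwards [ae_restrict_mem measurableSet_Ioc] with s hs
        obtain ⟨h0, h1⟩ := hit s (hRρ.trans hs.1).le
        rw [max_eq_left (hR.trans hs.1).le] at h1
        have h2 := Real.rpow_le_rpow h0 h1 hα0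
        rw [Real.mul_rpow hC (S.V_nonneg _)] at h2
        refine (mul_le_mul_of_nonneg_left h2 (hk s hs)).trans (le_of_eq ?_)
        ring
    rw [intervalIntegral.integral_const_mul] at h1
    have h2 := S.shell_le hRρ.le hRaR (by nlinarith)
    have h3 : ∫ τ in R..a * R, (a * R - τ) ^ m * τ ^ (1 - (m : ℤ)) * f τ * V τ ^ α ≤
        U (a * R) / c := by
      rw [le_div_iff₀ hc]
      linarith
    refine h1.trans ((mul_le_mul_of_nonneg_left h3 (Real.rpow_nonneg hC _)).trans (le_of_eq ?_))
    rw [hD]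
    ring
  have hy0 : 0 ≤ shellIntegral m a f α (iterate N ρ α β f g k).2 R := by
    refine intervalIntegral.integral_nonneg hRaR fun s hs => ?_
    exact mul_nonneg (mul_nonneg (mul_nonneg (pow_nonneg (sub_nonneg.2 hs.2) _)
      (zpow_nonneg (hR0.le.trans hs.1) _)) (S.f_nonneg s))
      (Real.rpow_nonneg (hit s (hRρ.le.trans hs.1)).1 _)
  have haR : ρ < a * R := hRρ.trans_le hRaR
  have hle : a * R ≤ b * R := by nlinarith
  have hr₀0 : 0 < r₀ := S.hρ.trans_le hr₀
  have hUaR : 0 < U (a * R) :=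
    hU.trans_le (S.monotoneOn_U hr₀0 (S.hρ.trans haR) (hR.le.trans hRaR))
  have hint := S.integral_density_le_rpow haR hle (by nlinarith) hUaR
  have hint0 : 0 ≤ ∫ s in (a * R)..(b * R), density m n α f g s :=
    intervalIntegral.integral_nonneg hle fun s hs => S.density_nonneg (haR.trans_le hs.1)
  calc growthFun N m n ρ α β a b f g k R
      ≤ (D * U (a * R)) ^ ε * (blowupConst N m n α β * U (a * R) ^ (-ε)) := by
        refine mul_le_mul ?_ hint hint0 (Real.rpow_nonneg (mul_nonneg hD0 hUaR.le) _)
        exact Real.rpow_le_rpow hy0 hy hε0.le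
    _ = D ^ ε * blowupConst N m n α β * (U (a * R) ^ ε * U (a * R) ^ (-ε)) := by
        rw [Real.mul_rpow hD0 hUaR.le]
        ring
    _ = _ := by
        rw [← Real.rpow_add hUaR, add_neg_cancel, Real.rpow_zero, mul_one]

/-- Positivity at one radius persists at all larger ones. If both means are positive somewhere, the
previous bound applies from a common radius; otherwise the density vanishes near infinity. -/
theorem exists_eventually_growthFun_le (S : RadialSystem N m n ρ α β f g U V) {a b : ℝ}
    (ha : 1 < a) (hab : a < b) (hb : b ≤ 2) (k : ℕ)
    (hne : (∃ r, 0 < r ∧ 0 < U r) ∨ ∃ r, 0 < r ∧ 0 < V r) :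
    ∃ C, ∀ᶠ R in atTop, growthFun N m n ρ α β a b f g k R ≤ C := by
  by_cases hU : ∃ r, 0 < r ∧ 0 < U r
  · obtain ⟨r₁, hr₁, hU⟩ := hU
    by_cases hV : ∃ r, 0 < r ∧ 0 < V r
    · obtain ⟨r₂, hr₂, hV⟩ := hV
      set r₀ := max ρ (max r₁ r₂) with hr₀
      have h1 : r₁ ≤ r₀ := (le_max_left _ _).trans (le_max_right _ _)
      have h2 : r₂ ≤ r₀ := (le_max_right _ _).trans (le_max_right _ _)
      exact S.exists_eventually_growthFun_le_of_pos ha hab hb k (le_max_left _ _)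
        (hU.trans_le (S.monotoneOn_U hr₁ (hr₁.trans_le h1) h1))
        (hV.trans_le (S.swap.monotoneOn_U hr₂ (hr₂.trans_le h2) h2))
    · have hV0 : ∀ r, 0 < r → V r = 0 := fun r hr =>
        le_antisymm (not_lt.1 fun h => hV ⟨r, hr, h⟩) (S.V_nonneg r)
      have h1 : r₁ ≤ max (ρ + 1) r₁ := le_max_right _ _
      have hρ1 : ρ < max (ρ + 1) r₁ := (lt_add_one ρ).trans_le (le_max_left _ _)
      exact ⟨0, (eventually_growthFun_eq_zero ha hab k fun s hs =>
        S.density_eq_zero_of_g_eq_zero (S.g_eq_zero_of_V_eq_zero hV0 hρ1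
          (hU.trans_le (S.monotoneOn_U hr₁ (hr₁.trans_le h1) h1)) hs)).mono fun _ h => h.le⟩
  · have hU0 : ∀ r, 0 < r → U r = 0 := fun r hr =>
      le_antisymm (not_lt.1 fun h => hU ⟨r, hr, h⟩) (S.U_nonneg r)
    obtain ⟨r₂, hr₂, hV⟩ := hne.resolve_left hU
    have h1 : r₂ ≤ max (ρ + 1) r₂ := le_max_right _ _
    have hρ1 : ρ < max (ρ + 1) r₂ := (lt_add_one ρ).trans_le (le_max_left _ _)
    exact ⟨0, (eventually_growthFun_eq_zero ha hab k fun s hs =>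
      S.density_eq_zero_of_f_eq_zero (S.swap.g_eq_zero_of_V_eq_zero hU0 hρ1
        (hV.trans_le (S.swap.monotoneOn_U hr₂ (hr₂.trans_le h1) h1)) hs)).mono fun _ h => h.le⟩

end RadialSystem

/-! ### Passage back to entire solutions. -/

theorem limsup_coe_ne_top {φ : ℝ → ℝ} (h : ∃ C, ∀ᶠ R in atTop, φ R ≤ C) :
    limsup (fun R => (φ R : EReal)) atTop ≠ ⊤ := by
  obtain ⟨C, hC⟩ := h
  have h1 : limsup (fun R => (φ R : EReal)) atTop ≤ (C : EReal) :=
    limsup_le_of_le (by isBoundedDefault) (hC.mono fun R hR => EReal.coe_le_coe_iff.2 hR)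
  exact (h1.trans_lt (EReal.coe_lt_top C)).ne

theorem exists_avg_pos {N : ℕ} [NeZero N] {u : Space N → ℝ} (hu : Continuous u)
    (hu0 : ∀ x, 0 ≤ u x) (hne : u ≠ 0) : ∃ r, 0 < r ∧ 0 < avg u r := by
  obtain ⟨x, hx⟩ := Function.ne_iff.1 hne
  have hopen : IsOpen {y | u y ≠ 0} := hu.isOpen_support
  -- The support is open and the complement of the origin is dense, so the point of positivity can
  -- be taken away from `0` and lies on a sphere of positive radius.
  obtain ⟨y, hy, hy0⟩ := (dense_compl_singleton (0 : Space N)).inter_open_nonempty _ hopen ⟨x, hx⟩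
  exact ⟨‖y‖, norm_pos_iff.2 hy0, avg_pos hu hu0 hy0 (lt_of_le_of_ne (hu0 y) (Ne.symm hy))⟩

end EllipticSystem
end

open EllipticSystem in
theorem theorem2 (N : ℕ) (hN : 3 ≤ N) (α β : ℝ) (hα : 1 ≤ α) (hβ : 1 ≤ β) (hαβ : 1 < α * β)
    (p q : Space N → ℝ) (hp : Continuous p) (hq : Continuous q)
    (hp0 : ∀ x, 0 ≤ p x) (hq0 : ∀ x, 0 ≤ q x)
    (m n : ℕ) (hm : 1 ≤ m) (hn : 1 ≤ n) (ρ : ℝ) (hρ : 0 < ρ)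
    (hpmono : AntitoneOn (fun r : ℝ => r ^ (1 - (m : ℤ)) * radialWeight α p r) (Set.Ioi ρ))
    (hqmono : AntitoneOn (fun r : ℝ => r ^ (1 - (n : ℤ)) * radialWeight β q r) (Set.Ioi ρ))
    (k : ℕ) (hk : 1 ≤ k) (a b : ℝ) (ha : 1 < a) (hab : a < b) (hb : b ≤ 2)
    (hlimsup :
      Filter.limsup (fun R : ℝ =>
        ((yFun N m ρ a α β (radialWeight α p) (radialWeight β q) k R
            ^ ((α * β - 1) / ((n + 1) * α + m + 1)) *
          ∫ s in (a * R)..(b * R),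
            (s ^ (1 - (m : ℤ)) * radialWeight α p s *
              (s ^ (1 - (n : ℤ)) * radialWeight β q s) ^ α)
              ^ (1 / ((n + 1) * α + m + 1)) : ℝ) : EReal)) Filter.atTop = ⊤
      ∨
      Filter.limsup (fun R : ℝ =>
        ((zFun N n ρ a α β (radialWeight α p) (radialWeight β q) k R
            ^ ((α * β - 1) / ((m + 1) * β + n + 1)) *
          ∫ s in (a * R)..(b * R),
            (s ^ (1 - (n : ℤ)) * radialWeight β q s *
              (s ^ (1 - (m : ℤ)) * radialWeight α p s) ^ β)
              ^ (1 / ((m + 1) * β + n + 1)) : ℝ) : EReal)) Filter.atTop = ⊤) :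
    ¬ ∃ u v : Space N → ℝ, IsNonnegEntireSolution α β p q u v ∧ ¬ (u = 0 ∧ v = 0) := by
  rintro ⟨u, v, hsol, hne⟩
  have : NeZero N := ⟨by omega⟩
  have huc := hsol.contDiff_u.continuous
  have hvc := hsol.contDiff_v.continuous
  have S : RadialSystem N m n ρ α β (radialWeight α p) (radialWeight β q) (avg u) (avg v) :=
    { hN := hN, hm := hm, hn := hn, hρ := hρ, hα := hα, hβ := hβ, hαβ := hαβ
      f_nonneg := radialWeight_nonneg hp0
      g_nonneg := radialWeight_nonneg hq0
      f_int := fun _ _ => intervalIntegrable_radialWeight hα hp hp0 hm hρ hpmono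
      g_int := fun _ _ => intervalIntegrable_radialWeight hβ hq hq0 hn hρ hqmono
      f_anti := hpmono
      g_anti := hqmono
      U_cont := continuous_avg huc
      V_cont := continuous_avg hvc
      U_nonneg := avg_nonneg hsol.nonneg_u
      V_nonneg := avg_nonneg hsol.nonneg_v
      U_growth := radialGrowth_avg hN hα hp hp0 hsol.contDiff_u hvc hsol.nonneg_v hsol.eq_u
      V_growth := radialGrowth_avg hN hβ hq hq0 hsol.contDiff_v huc hsol.nonneg_u hsol.eq_v }
  have hpos : (∃ r, 0 < r ∧ 0 < avg u r) ∨ ∃ r, 0 < r ∧ 0 < avg v r := by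
    by_cases hu : u = 0
    · exact Or.inr (exists_avg_pos hvc hsol.nonneg_v fun hv => hne ⟨hu, hv⟩)
    · exact Or.inl (exists_avg_pos huc hsol.nonneg_u hu)
  rcases hlimsup with h | h
  · exact limsup_coe_ne_top (S.exists_eventually_growthFun_le ha hab hb k hpos) h
  · refine limsup_coe_ne_top (S.swap.exists_eventually_growthFun_le ha hab hb k hpos.symm) ?_
    refine Eq.trans ?_ h
    congr 1
    ext R
    simp only [RadialSystem.growthFun, RadialSystem.density, yFun, zFun, iterate_swap N ρ α β,
      Prod.snd_swap, mul_comm β α]
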